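/- Let $1<\alpha<\beta<\infty$ and $\Omega=(-\infty,0)\cup(1,\alpha)\cup(\beta,\infty)$, and write $e(x)=e^{2\pi i x}$. For $B\in U(2)$ let $P_B=\frac{1}{2\pi i}\frac{d}{dx}$ be the operator in $L^2(\Omega)$ whose domain consists of the absolutely continuous $f$ on $\Omega$ with $f,f'\in L^2(\Omega)$ and $$B\begin{pmatrix} f(1)\\ f(\beta)\end{pmatrix}=\begin{pmatrix} f(0)\\ f(\alpha)\end{pmatrix}$$ (boundary values taken from inside $\Omega$). Write $$B=\begin{pmatrix} w\,e(\phi) & -\sqrt{1-w^2}\,e(\theta-\psi)\\ \sqrt{1-w^2}\,e(\psi) & w\,e(\theta-\phi)\end{pmatrix},\qquad 0\le w\le 1,$$ and $w(B)=w$. For $w(B)>0$ let $\sigma_B(d\lambda)=m_B(\lambda)^{-2}\,d\lambda$ on $\mathbb R$, where $m_B(\lambda)=w^{-1}\bigl|1-\sqrt{1-w^2}\,e(-\psi+(\alpha-1)\lambda)\bigr|$. **Corollary 3.31.** For every $B\in U(2)$ with $0<w(B)<1$ there is a unique strongly continuous unitary one-parameter group $U_B(t)=e^{-2\pi i tP_B}$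 on $L^2(\Omega)$ with infinitesimal generator $-2\pi i P_B$, and any two of the groups $U_B$ with $0<w(B)<1$ are unitarily equivalent: for such $B,B'$ there is a unitary operator $W$ on $L^2(\Omega)$ with $W U_B(t)=U_{B'}(t)W$ for all $t\in\mathbb R$. Moreover, for each such $B$ the group $U_B(t)$ is unitarily equivalent to the group of multiplications $g(\lambda)\mapsto e(-t\lambda)g(\lambda)$ on $L^2(\mathbb R,\sigma_B)$, and $\sigma_B$ and Lebesgue measure are mutually absolutely continuous. -/

import Mathlib

open MeasureTheory Set

noncomputable section

namespace ExteriorMomentum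

/-- The exterior domain `Ω = (-∞, 0) ∪ (1, α) ∪ (β, ∞)`. -/
def Omega (α β : ℝ) : Set ℝ := Iio 0 ∪ Ioo 1 α ∪ Ioi β

/-- The Hilbert space `L²(Ω)` (with respect to Lebesgue measure). -/
abbrev L2Omega (α β : ℝ) : Type := Lp ℂ 2 (volume.restrict (Omega α β))

/-- `e(x) = exp(2πix)`. -/
def e (x : ℝ) : ℂ := Complex.exp (2 * Real.pi * Complex.I * x)

/-- `F` is an absolutely continuous version of `f ∈ L²(Ω)`, and `(2πi)⁻¹ F' = g` almost everywhere.
Absolute continuity is on every compact interval in the closure of `Ω`, so that `F 0`, `F 1`, `F α`,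
`F β` are the boundary values of `f`. (If `F` is locally absolutely continuous on `Ω` with `F'` in
`L²(Ω)`, then it always extends in this way.) -/
structure IsACVersion (α β : ℝ) (f g : L2Omega α β) (F : ℝ → ℂ) : Prop where
  ae_eq : f =ᵐ[volume.restrict (Omega α β)] F
  absCont : ∀ a b : ℝ, a ≤ b → Icc a b ⊆ closure (Omega α β) →
    AbsolutelyContinuousOnInterval F a b
  hasDerivAt : ∀ᵐ x ∂(volume.restrict (Omega α β)),
    HasDerivAt F (2 * Real.pi * Complex.I * g x) x

/-- The graph of the momentum operator `P_B`: the pairs `(f, (2πi)⁻¹ f')`, where `f` is absolutely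
continuous, `f` and `f'` are square-integrable on `Ω`, and `B (f(1), f(β)) = (f(0), f(α))`. -/
def momentumGraph (α β : ℝ) (B : Matrix.unitaryGroup (Fin 2) ℂ) :
    Submodule ℂ (L2Omega α β × L2Omega α β) where
  carrier := {p | ∃ F : ℝ → ℂ, IsACVersion α β p.1 p.2 F ∧
    (B : Matrix (Fin 2) (Fin 2) ℂ).mulVec ![F 1, F β] = ![F 0, F α]}
  zero_mem' := by
    refine ⟨0, ⟨Lp.coeFn_zero _ _ _, fun a b _ _ => ?_, ?_⟩, ?_⟩
    · exact ((LipschitzWith.const (0 : ℂ)).lipschitzOnWith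
        (s := uIcc a b)).absolutelyContinuousOnInterval
    · filter_upwards [Lp.coeFn_zero ℂ 2 (volume.restrict (Omega α β))] with x hx
      change HasDerivAt (0 : ℝ → ℂ)
        (2 * Real.pi * Complex.I * (0 : L2Omega α β) x) x
      rw [hx, Pi.zero_apply, mul_zero]
      exact hasDerivAt_const x (0 : ℂ)
    · ext i; fin_cases i <;> simp [Matrix.mulVec, dotProduct]
  add_mem' := by
    rintro ⟨f, g⟩ ⟨f', g'⟩ ⟨F, hF, bF⟩ ⟨F', hF', bF'⟩
    refine ⟨F + F', ⟨?_, fun a b hab hs => (hF.absCont a b hab hs).add (hF'.absCont a b hab hs),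
      ?_⟩, ?_⟩
    · exact (Lp.coeFn_add f f').trans (hF.ae_eq.add hF'.ae_eq)
    · filter_upwards [Lp.coeFn_add g g', hF.hasDerivAt, hF'.hasDerivAt] with x hx h h'
      have := h.add h'
      rwa [← mul_add, ← Pi.add_apply, ← hx] at this
    · have h1 : ![(F + F') 1, (F + F') β] = ![F 1, F β] + ![F' 1, F' β] := by
        ext i; fin_cases i <;> simp
      rw [h1, Matrix.mulVec_add, bF, bF']
      ext i; fin_cases i <;> simp
  smul_mem' := by
    rintro c ⟨f, g⟩ ⟨F, hF, bF⟩
    refine ⟨c • F, ⟨?_, fun a b hab hs => (hF.absCont a b hab hs).const_smul c,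
      ?_⟩, ?_⟩
    · exact (Lp.coeFn_smul c f).trans (hF.ae_eq.const_smul c)
    · filter_upwards [Lp.coeFn_smul c g, hF.hasDerivAt] with x hx h
      have h2 := h.const_smul c
      have h3 : (2 * Real.pi * Complex.I * (c • g : L2Omega α β) x : ℂ)
          = c • (2 * Real.pi * Complex.I * g x) := by
        rw [hx]; simp only [Pi.smul_apply, smul_eq_mul]; ring
      change HasDerivAt (c • F) (2 * Real.pi * Complex.I * (c • g : L2Omega α β) x) x
      rw [h3]; exact h2
    · have h1 : ![(c • F) 1, (c • F) β] = c • ![F 1, F β] := by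
        ext i; fin_cases i <;> simp
      rw [h1, Matrix.mulVec_smul, bF]
      ext i; fin_cases i <;> simp

lemma isOpen_Omega (α β : ℝ) : IsOpen (Omega α β) :=
  (isOpen_Iio.union isOpen_Ioo).union isOpen_Ioi

/-- The relation `momentumGraph` is single-valued. -/
lemma momentumGraph_single_valued {α β : ℝ} {B : Matrix.unitaryGroup (Fin 2) ℂ}
    (p : L2Omega α β × L2Omega α β) (hp : p ∈ momentumGraph α β B) (h0 : p.1 = 0) : p.2 = 0 := by
  obtain ⟨f, g⟩ := p
  obtain ⟨F, hF, -⟩ := hp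
  obtain rfl : f = 0 := h0
  have hcont : ContinuousOn F (Omega α β) := by
    intro x hx
    obtain ⟨ε, hε, hb⟩ := Metric.isOpen_iff.1 (isOpen_Omega α β) x hx
    have hsub : Icc (x - ε / 2) (x + ε / 2) ⊆ Omega α β := by
      intro y hy
      apply hb
      rw [Metric.mem_ball, Real.dist_eq, abs_lt]
      constructor <;> linarith [hy.1, hy.2]
    have hc := (hF.absCont (x - ε / 2) (x + ε / 2) (by linarith)
      (hsub.trans subset_closure)).continuousOn
    rw [uIcc_of_le (by linarith)] at hc
    exact (hc.continuousAt (Icc_mem_nhds (by linarith) (by linarith))).continuousWithinAt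
  have hz : EqOn F (fun _ => 0) (Omega α β) :=
    Measure.eqOn_open_of_ae_eq (hF.ae_eq.symm.trans (Lp.coeFn_zero _ _ _)) (isOpen_Omega α β)
      hcont continuousOn_const
  apply Lp.ext
  filter_upwards [hF.hasDerivAt, Lp.coeFn_zero ℂ 2 (volume.restrict (Omega α β)),
    ae_restrict_mem (isOpen_Omega α β).measurableSet] with x hd h0 hx
  have hev : F =ᶠ[nhds x] fun _ => 0 :=
    Filter.eventuallyEq_of_mem ((isOpen_Omega α β).mem_nhds hx) hz
  have h2 := hd.unique ((hasDerivAt_const x (0 : ℂ)).congr_of_eventuallyEq hev)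
  have h3 : g x = 0 := by simpa [Real.pi_ne_zero] using h2
  rw [h0]; simpa using h3

/-- The momentum operator `P_B = (2πi)⁻¹ d/dx` in `L²(Ω)` with boundary condition
`B (f(1), f(β)) = (f(0), f(α))`, as an unbounded operator. -/
def momentum (α β : ℝ) (B : Matrix.unitaryGroup (Fin 2) ℂ) :
    L2Omega α β →ₗ.[ℂ] L2Omega α β :=
  (momentumGraph α β B).toLinearPMap

lemma momentum_graph (α β : ℝ) (B : Matrix.unitaryGroup (Fin 2) ℂ) :
    (momentum α β B).graph = momentumGraph α β B :=
  Submodule.toLinearPMap_graph_eq _ momentumGraph_single_valued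

/-- `U` is a strongly continuous unitary one-parameter group and `U(t) = exp(-2πitA)`: the
operator `-2πiA` is its infinitesimal generator, with equality of domains. -/
structure IsUnitaryGroupOf {H : Type*} [NormedAddCommGroup H] [InnerProductSpace ℂ H]
    (U : ℝ → H ≃ₗᵢ[ℂ] H) (A : H →ₗ.[ℂ] H) : Prop where
  map_add : ∀ s t f, U (s + t) f = U s (U t f)
  continuous : ∀ f, Continuous fun t => U t f
  generator : ∀ f g, (f, g) ∈ A.graph ↔
    HasDerivAt (fun t : ℝ => U t f) (-(2 * Real.pi * Complex.I) • g) 0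

/-- Unitary equivalence of two families of unitary operators indexed by `ℝ`. -/
def UnitarilyEquivalent {H K : Type*} [NormedAddCommGroup H] [InnerProductSpace ℂ H]
    [NormedAddCommGroup K] [InnerProductSpace ℂ K]
    (U : ℝ → H ≃ₗᵢ[ℂ] H) (V : ℝ → K ≃ₗᵢ[ℂ] K) : Prop :=
  ∃ W : H ≃ₗᵢ[ℂ] K, ∀ t f, W (U t f) = V t (W f)

/-- The parameter `w(B) ∈ [0, 1]`: every `B ∈ U(2)` is of the form
`!![w e(φ), -√(1-w²) e(θ-ψ); √(1-w²) e(ψ), w e(θ-φ)]`, and `w(B) = w` is the modulus of the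
diagonal entries. -/
def wParam (B : Matrix.unitaryGroup (Fin 2) ℂ) : ℝ := ‖(B : Matrix (Fin 2) (Fin 2) ℂ) 0 0‖

/-- The coefficient `a_B(λ) = w⁻¹ e(φ) e(λ) (1 - √(1-w²) e(-ψ + (α-1)λ))` on `(-∞, 0)` of the
generalized eigenfunction `ψ_λ = (a_B(λ) χ₋ + χ₀ + c_B(λ) χ₊) e(λ ·)` of `P_B`, for `w(B) ≠ 0`;
here `w⁻¹ e(φ)` is the inverse of the conjugate of `B₀₀`, and `√(1-w²) e(-ψ)` is the conjugate
of `B₁₀`. -/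
def aCoeff (α : ℝ) (B : Matrix.unitaryGroup (Fin 2) ℂ) (l : ℝ) : ℂ :=
  (starRingEnd ℂ ((B : Matrix (Fin 2) (Fin 2) ℂ) 0 0))⁻¹ * e l *
    (1 - starRingEnd ℂ ((B : Matrix (Fin 2) (Fin 2) ℂ) 1 0) * e ((α - 1) * l))

/-- The spectral measure `σ_B(dλ) = m_B(λ)⁻² dλ` on `ℝ`, where `m_B = |a_B|`. -/
def sigma (α : ℝ) (B : Matrix.unitaryGroup (Fin 2) ℂ) : Measure ℝ :=
  volume.withDensity fun l => ENNReal.ofReal ((‖aCoeff α B l‖ ^ 2)⁻¹)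

end ExteriorMomentum

end

open MeasureTheory Set

noncomputable section

namespace ExteriorMomentum

/-! ### One-parameter unitary groups: domain, resolvent and uniqueness. -/

section UnitaryGroup

open Filter Topology

variable {H : Type*} [NormedAddCommGroup H] [InnerProductSpace ℂ H]

/-! The group `exp(-2πitP_B)` moves functions to the right at unit speed. What leaves at 0 and α
re-enters at 1 and β according to `(f(1), f(β)) = B* (f(0), f(α))`. For w > 0 the loop (1, α) leaks,
since |B₁₀|² = 1 - w² < 1, so the whole history is determined by one incoming wave k ∈ L²(ℝ): the
loop wave solves `h(x) = B̄₀₀ k(x) + B̄₁₀ h(x + α - 1)` by a Neumann series, and the outgoing wave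
is `o(x) = B̄₀₁ k(x) + B̄₁₁ h(x + α - 1)`.

The map V from k to the state (k on x < 0, h on the loop, o beyond β) is unitary (`norm_waveMap`,
`waveMap_surjective`), and h and o depend on k translation-invariantly. Hence V carries translation
to a unitary group on L²(Ω). Its generator is contained in -2πiP_B because the wave equations at x =
0 are the boundary condition (`momentumGraph_of_hasDerivAt`). Equality follows because a resolvent
equation is solvable for the group and has at most one solution for P_B (`exists_resolvent`,
`momentumGraph_deficiency`).

Every U_B is thus conjugate to the same translation group, so all are equivalent. The Fourier
transform turns translation into multiplication by e(-tλ), and multiplication by the nowhere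
vanishing a_B maps L²(dλ) onto L²(σ_B). -/

lemma group_zero {U : ℝ → H ≃ₗᵢ[ℂ] H} (hU : ∀ s t f, U (s + t) f = U s (U t f)) (f : H) :
    U 0 f = f := by
  have := hU 0 0 f
  rw [add_zero] at this
  exact ((U 0).injective this).symm

lemma hasDerivAt_orbit {U : ℝ → H ≃ₗᵢ[ℂ] H} (hU : ∀ s t f, U (s + t) f = U s (U t f)) {f g : H}
    (h : HasDerivAt (fun t => U t f) g 0) (t : ℝ) : HasDerivAt (fun s => U s f) (U t g) t := by
  have h1 : HasDerivAt (fun s : ℝ => U (s - t) f) g t := by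
    have h0 : HasDerivAt (fun t => U t f) g (t - t) := by simpa using h
    exact h0.comp_sub_const t t
  have h2 := ((U t).toContinuousLinearEquiv.toContinuousLinearMap.restrictScalars
    ℝ).hasFDerivAt.comp_hasDerivAt t h1
  refine h2.congr_of_eventuallyEq (Eventually.of_forall fun s => ?_)
  have := hU t (s - t) f
  rw [add_sub_cancel] at this
  exact this

/-- The domain of the generator is invariant and the group commutes with the generator; the
uniqueness proof needs both. -/
lemma hasDerivAt_group_apply {U : ℝ → H ≃ₗᵢ[ℂ] H} (hU : ∀ s t f, U (s + t) f = U s (U t f))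
    {f g : H} (h : HasDerivAt (fun t => U t f) g 0) (t : ℝ) :
    HasDerivAt (fun s => U s (U t f)) (U t g) 0 := by
  have h1 : HasDerivAt (fun s : ℝ => U (s + t) f) (U t g) 0 := by
    have h0 : HasDerivAt (fun t => U t f) (U t g) (0 + t) := by
      simpa using hasDerivAt_orbit hU h t
    exact h0.comp_add_const 0 t
  simpa only [hU] using h1

/-- The infinitesimal generator of a unitary group is skew-symmetric. -/
lemma re_inner_generator {U : ℝ → H ≃ₗᵢ[ℂ] H} (hU : ∀ s t f, U (s + t) f = U s (U t f))
    {f g : H} (h : HasDerivAt (fun t => U t f) g 0) : (inner ℂ f g).re = 0 := by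
  have h1 := h.inner ℂ h
  have h2 : (fun t : ℝ => inner ℂ (U t f) (U t f)) = fun _ => inner ℂ f f := by
    ext t; simp
  rw [h2] at h1
  have h3 := h1.unique (hasDerivAt_const _ _)
  rw [group_zero hU, ← inner_conj_symm f g] at h3
  have h4 := congrArg Complex.re h3
  simp at h4
  have h5 : (inner ℂ g f).re = (inner ℂ f g).re := by
    rw [← inner_conj_symm, Complex.conj_re]
  linarith

/-- Averages of an orbit over [0, x] lie in the domain, because the group only shifts the interval
of integration, and they tend to m as x → 0. -/
lemma dense_generator_domain [CompleteSpace H] {U : ℝ → H ≃ₗᵢ[ℂ] H}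
    (hU : ∀ s t f, U (s + t) f = U s (U t f)) (hc : ∀ f, Continuous fun t => U t f) :
    Dense {f : H | ∃ g, HasDerivAt (fun t => U t f) g 0} := by
  intro m
  have hint : ∀ a b : ℝ, IntervalIntegrable (fun s => U s m) volume a b :=
    fun a b => (hc m).intervalIntegrable a b
  have hd : ∀ x : ℝ, HasDerivAt (fun x => ∫ s in (0 : ℝ)..x, U s m) (U x m) x := fun x =>
    intervalIntegral.integral_hasDerivAt_right (hint 0 x)
      (hc m).aestronglyMeasurable.stronglyMeasurableAtFilter (hc m).continuousAt
  have hlim : Tendsto (fun x : ℝ => x⁻¹ • ∫ s in (0 : ℝ)..x, U s m) (𝓝[≠] 0) (𝓝 m) := by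
    have := (hd 0).tendsto_slope_zero
    simpa [group_zero hU] using this
  refine mem_closure_of_tendsto hlim (Eventually.of_forall fun x => ?_)
  refine ⟨x⁻¹ • (U x m - U 0 m), ?_⟩
  have key : ∀ t : ℝ, U t (x⁻¹ • ∫ s in (0 : ℝ)..x, U s m)
      = x⁻¹ • ((∫ s in (0 : ℝ)..(x + t), U s m) - ∫ s in (0 : ℝ)..t, U s m) := by
    intro t
    have h1 : U t (∫ s in (0 : ℝ)..x, U s m) = ∫ s in (0 : ℝ)..x, U t (U s m) :=
      (((U t).toContinuousLinearEquiv.toContinuousLinearMap.restrictScalars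
        ℝ).intervalIntegral_comp_comm (hint 0 x)).symm
    have h2 : U t (x⁻¹ • ∫ s in (0 : ℝ)..x, U s m) = x⁻¹ • U t (∫ s in (0 : ℝ)..x, U s m) :=
      ((U t).toContinuousLinearEquiv.toContinuousLinearMap.restrictScalars ℝ).map_smul _ _
    rw [h2, h1]
    simp only [← hU]
    have h3 := intervalIntegral.integral_comp_add_left (a := 0) (b := x) (fun s => U s m) t
    rw [h3, add_zero, add_comm t x, intervalIntegral.integral_interval_sub_left (hint _ _) (hint _ _)]
  simp only [key]
  have h4 : HasDerivAt (fun t : ℝ => ∫ s in (0 : ℝ)..(x + t), U s m) (U x m) 0 := by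
    have h0 := hd (x + 0)
    simpa using h0.comp_const_add x 0
  exact (h4.sub (hd 0)).const_smul _

/-- The resolvent of the generator: `f - f' = m` has a solution, where `f'` is the derivative
of the orbit of `f`. -/
lemma exists_resolvent [CompleteSpace H] {U : ℝ → H ≃ₗᵢ[ℂ] H}
    (hU : ∀ s t f, U (s + t) f = U s (U t f)) (hc : ∀ f, Continuous fun t => U t f) (m : H) :
    ∃ f, HasDerivAt (fun t => U t f) (f - m) 0 := by
  -- The solution is the Laplace transform ∫₀^∞ e^{-s} U_s m ds; shifting s makes its orbit e^t (f -
  -- ∫₀^t φ), with derivative f - m at 0.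
  set φ : ℝ → H := fun s => Real.exp (-s) • U s m with hφ
  have hφc : Continuous φ := by
    have := hc m
    fun_prop
  have hφi : ∀ a, IntegrableOn φ (Ioi a) := by
    intro a
    refine Integrable.mono' ((exp_neg_integrableOn_Ioi a one_pos).mul_const ‖m‖)
      hφc.aestronglyMeasurable (Eventually.of_forall fun s => ?_)
    simp [hφ, norm_smul]
  refine ⟨∫ s in Ioi (0 : ℝ), φ s, ?_⟩
  have hint : ∀ a b : ℝ, IntervalIntegrable φ volume a b := fun a b => hφc.intervalIntegrable a b
  have hd : HasDerivAt (fun x => ∫ s in (0 : ℝ)..x, φ s) (φ 0) 0 :=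
    intervalIntegral.integral_hasDerivAt_right (hint 0 0)
      hφc.aestronglyMeasurable.stronglyMeasurableAtFilter hφc.continuousAt
  have key : ∀ t : ℝ, U t (∫ s in Ioi (0 : ℝ), φ s)
      = Real.exp t • ((∫ s in Ioi (0 : ℝ), φ s) - ∫ s in (0 : ℝ)..t, φ s) := by
    intro t
    have h1 : U t (∫ s in Ioi (0 : ℝ), φ s) = ∫ s in Ioi (0 : ℝ), U t (φ s) :=
      (((U t).toContinuousLinearEquiv.toContinuousLinearMap.restrictScalars
        ℝ).integral_comp_comm (hφi 0)).symm
    have h2 : ∀ s, U t (φ s) = Real.exp t • φ (s + t) := by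
      intro s
      have h3 : U t (φ s) = Real.exp (-s) • U t (U s m) :=
        ((U t).toContinuousLinearEquiv.toContinuousLinearMap.restrictScalars ℝ).map_smul _ _
      rw [h3, ← hU, hφ]
      simp only [smul_smul, ← Real.exp_add]
      rw [add_comm t s]; congr 2; ring
    rw [h1]
    simp only [h2]
    rw [integral_smul]
    congr 1
    have h4 : ∫ s in Ioi (0 : ℝ), φ (s + t) = ∫ s in Ioi t, φ s := by
      have := (measurePreserving_add_right volume t).setIntegral_preimage_emb
        (measurableEmbedding_addRight t) φ (Ioi t)
      simpa using this
    rw [h4, ← intervalIntegral.integral_Ioi_sub_Ioi' (hφi 0) (hφi t)]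
    simp
  simp only [key]
  have h5 := (Real.hasDerivAt_exp 0).smul (hd.const_sub (∫ s in Ioi (0 : ℝ), φ s))
  have h6 : φ 0 = m := by simp [hφ, group_zero hU]
  rw [h6] at h5
  refine h5.congr_deriv ?_
  simp
  abel

lemma IsUnitaryGroupOf.unique [CompleteSpace H] {U U' : ℝ → H ≃ₗᵢ[ℂ] H} {A : H →ₗ.[ℂ] H}
    (h : IsUnitaryGroupOf U A) (h' : IsUnitaryGroupOf U' A) : U = U' := by
  funext t
  ext1 f
  have hcl : IsClosed {f : H | U t f = U' t f} :=
    isClosed_eq (U t).continuous (U' t).continuous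
  have hc0 : (2 * Real.pi * Complex.I : ℂ) ≠ 0 := by simp [Real.pi_ne_zero]
  have hsub : {f : H | ∃ g, HasDerivAt (fun t => U t f) g 0} ⊆ {f : H | U t f = U' t f} := by
    rintro f ⟨g, hg⟩
    obtain ⟨g₁, rfl⟩ : ∃ g₁ : H, g = -(2 * Real.pi * Complex.I : ℂ) • g₁ :=
      ⟨(-(2 * Real.pi * Complex.I : ℂ))⁻¹ • g, by
        rw [smul_inv_smul₀ (neg_ne_zero.2 hc0)]⟩
    have hA := (h.generator f g₁).2 hg
    have hg' := (h'.generator f g₁).1 hA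
    set c : ℂ := -(2 * Real.pi * Complex.I : ℂ) with hcdef
    have hw : ∀ s, (U s f - U' s f, U s g₁ - U' s g₁) ∈ A.graph := fun s => by
      have a1 : (U s f, U s g₁) ∈ A.graph := (h.generator _ _).2 (by
        have := hasDerivAt_group_apply h.map_add hg s
        rwa [map_smul] at this)
      have a2 : (U' s f, U' s g₁) ∈ A.graph := (h'.generator _ _).2 (by
        have := hasDerivAt_group_apply h'.map_add hg' s
        rwa [map_smul] at this)
      exact A.graph.sub_mem a1 a2
    have hd : ∀ s, HasDerivAt (fun s => U s f - U' s f) (c • (U s g₁ - U' s g₁)) s := fun s => by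
      have := (hasDerivAt_orbit h.map_add hg s).sub (hasDerivAt_orbit h'.map_add hg' s)
      rwa [map_smul, map_smul, ← smul_sub] at this
    have hn : ∀ s, HasDerivAt (fun s => (inner ℂ (U s f - U' s f) (U s f - U' s f)).re) 0 s := by
      intro s
      have h1 := (hd s).inner ℂ (hd s)
      have h2 := Complex.reCLM.hasFDerivAt.comp_hasDerivAt s h1
      -- The difference of the two orbits stays in the graph of `A`, so skew symmetry of the
      -- generator of `U` makes its norm constant; it starts at 0.
      have h3 := re_inner_generator h.map_add ((h.generator _ _).1 (hw s))
      have h4 : (inner ℂ (c • (U s g₁ - U' s g₁)) (U s f - U' s f)).re = 0 := by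
        rw [← inner_conj_symm, Complex.conj_re]; exact h3
      refine h2.congr_deriv ?_
      rw [Complex.reCLM_apply, Complex.add_re, h3, h4, add_zero]
    have h5 := is_const_of_deriv_eq_zero (fun s => (hn s).differentiableAt) (fun s => (hn s).deriv) t 0
    simp only [group_zero h.map_add, group_zero h'.map_add, sub_self, inner_zero_left,
      Complex.zero_re] at h5
    have h6 : ‖U t f - U' t f‖ ^ 2 = 0 := by
      rw [← h5]; exact norm_sq_eq_re_inner (𝕜 := ℂ) _
    simpa [sub_eq_zero] using h6
  exact hcl.closure_subset_iff.2 hsub (dense_generator_domain h.map_add h.continuous f)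

end UnitaryGroup

/-! ### The translation group on L²(ℝ). -/

section Translation

open Filter Topology

/-- The Hilbert space `L²(ℝ)`. -/
abbrev L2R : Type := Lp ℂ 2 (volume : Measure ℝ)

lemma translation_aux (s t : ℝ) (hst : s + t = 0) (f : L2R) :
    Lp.compMeasurePreserving (· - s) (measurePreserving_sub_right volume s)
      (Lp.compMeasurePreserving (· - t) (measurePreserving_sub_right volume t) f) = f := by
  rw [← Lp.compMeasurePreserving_comp_apply]
  have : ((fun x => x - t) ∘ fun x : ℝ => x - s) = id := by
    funext x; simp only [Function.comp, id]; linarith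
  simp only [this]
  exact Lp.compMeasurePreserving_id_apply f

/-- Translation by `t` on `L²(ℝ)`. -/
def translation (t : ℝ) : L2R ≃ₗᵢ[ℂ] L2R where
  toFun := Lp.compMeasurePreserving (· - t) (measurePreserving_sub_right volume t)
  invFun := Lp.compMeasurePreserving (· - -t) (measurePreserving_sub_right volume (-t))
  map_add' := map_add _
  map_smul' c f := (Lp.compMeasurePreservingₗ ℂ (· - t)
    (measurePreserving_sub_right volume t)).map_smul c f
  left_inv f := translation_aux _ _ (by simp) f
  right_inv f := translation_aux _ _ (by simp) f
  norm_map' f := Lp.norm_compMeasurePreserving f _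

lemma translation_ae (t : ℝ) (f : L2R) : translation t f =ᵐ[volume] fun x => f (x - t) :=
  Lp.coeFn_compMeasurePreserving f (measurePreserving_sub_right volume t)

lemma ae_comp_sub {P : ℝ → Prop} (h : ∀ᵐ x, P x) (t : ℝ) : ∀ᵐ x : ℝ, P (x - t) :=
  (measurePreserving_sub_right volume t).quasiMeasurePreserving.ae h

lemma ae_comp_add {P : ℝ → Prop} (h : ∀ᵐ x, P x) (t : ℝ) : ∀ᵐ x : ℝ, P (x + t) :=
  (measurePreserving_add_right volume t).quasiMeasurePreserving.ae h

lemma translation_add (s t : ℝ) (f : L2R) :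
    translation (s + t) f = translation s (translation t f) := by
  apply Lp.ext
  filter_upwards [translation_ae (s + t) f, translation_ae s (translation t f),
    ae_comp_sub (translation_ae t f) s] with x h1 h2 h3
  rw [h1, h2, h3, sub_sub]

lemma translation_comm (s t : ℝ) (f : L2R) :
    translation s (translation t f) = translation t (translation s f) := by
  rw [← translation_add, add_comm, translation_add]

lemma continuous_translation (f : L2R) : Continuous fun t => translation t f := by
  -- Strong continuity reduces to continuity of t ↦ (x ↦ x - t) in the compact-open topology.
  have hg : Continuous fun t : ℝ => (⟨fun x : ℝ => x - t, by fun_prop⟩ : C(ℝ, ℝ)) :=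
    ContinuousMap.continuous_of_continuous_uncurry _
      (show Continuous fun z : ℝ × ℝ => z.2 - z.1 by fun_prop)
  exact (continuous_const (y := f)).compMeasurePreservingLp hg
    (fun t => measurePreserving_sub_right volume t) (by norm_num)

end Translation

/-! ### The generator of translations and absolutely continuous primitives. -/

section AbsolutelyContinuous

open Filter Topology

/-- Used to compare a complex primitive of f with the real primitive of ‖f‖. -/
lemma absolutelyContinuousOnInterval_of_dist_le {X Y : Type*} [PseudoMetricSpace X]
    [PseudoMetricSpace Y] {f : ℝ → X} {g : ℝ → Y} {a b : ℝ}
    (hg : AbsolutelyContinuousOnInterval g a b)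
    (h : ∀ x ∈ uIcc a b, ∀ y ∈ uIcc a b, dist (f x) (f y) ≤ dist (g x) (g y)) :
    AbsolutelyContinuousOnInterval f a b := by
  rw [absolutelyContinuousOnInterval_iff] at hg ⊢
  intro ε hε
  obtain ⟨δ, hδ, hd⟩ := hg ε hε
  refine ⟨δ, hδ, fun E hE hl => lt_of_le_of_lt (Finset.sum_le_sum fun i hi => ?_) (hd E hE hl)⟩
  exact h _ (hE.1 i hi).1 _ (hE.1 i hi).2

lemma absolutelyContinuousOnInterval_congr {X : Type*} [PseudoMetricSpace X]
    {f g : ℝ → X} {a b : ℝ} (hg : AbsolutelyContinuousOnInterval g a b)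
    (h : EqOn f g (uIcc a b)) : AbsolutelyContinuousOnInterval f a b :=
  absolutelyContinuousOnInterval_of_dist_le hg fun x hx y hy => by rw [h hx, h hy]

lemma intervalIntegrable_of_locallyIntegrable {f : ℝ → ℂ} (hf : LocallyIntegrable f) (a b : ℝ) :
    IntervalIntegrable f volume a b :=
  intervalIntegrable_iff.mpr
    ((hf.integrableOn_isCompact isCompact_uIcc).mono_set uIoc_subset_uIcc)

lemma absolutelyContinuousOnInterval_primitive {f : ℝ → ℂ} (hf : LocallyIntegrable f) (k : ℂ)
    (c a b : ℝ) : AbsolutelyContinuousOnInterval (fun x => k + ∫ v in c..x, f v) a b := by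
  have hi : ∀ x y : ℝ, IntervalIntegrable f volume x y := fun x y =>
    intervalIntegrable_of_locallyIntegrable hf x y
  have hn : IntervalIntegrable (fun v => ‖f v‖) volume a b := (hi a b).norm
  refine absolutelyContinuousOnInterval_of_dist_le
    (hn.absolutelyContinuousOnInterval_intervalIntegral left_mem_uIcc) fun x hx y hy => ?_
  rw [dist_add_left, dist_eq_norm, dist_eq_norm,
    intervalIntegral.integral_interval_sub_left (hi _ _) (hi _ _),
    intervalIntegral.integral_interval_sub_left (hi _ _).norm (hi _ _).norm]
  exact intervalIntegral.norm_integral_le_abs_integral_norm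

/-- `K` is an absolutely continuous version of `k ∈ L²(ℝ)` with `K' = 2πi l`. -/
structure IsPrimitiveVersion (k l : L2R) (K : ℝ → ℂ) : Prop where
  ae_eq : k =ᵐ[volume] K
  absCont : ∀ a b, AbsolutelyContinuousOnInterval K a b
  hasDerivAt : ∀ᵐ x, HasDerivAt K (2 * Real.pi * Complex.I * l x) x

lemma L2R.locallyIntegrable (f : L2R) : LocallyIntegrable f :=
  (Lp.memLp f).locallyIntegrable (by norm_num)

lemma IsPrimitiveVersion.continuous {k l : L2R} {K : ℝ → ℂ} (h : IsPrimitiveVersion k l K) :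
    Continuous K := by
  refine continuous_iff_continuousAt.2 fun x => ?_
  have := (h.absCont (x - 1) (x + 1)).continuousOn
  rw [uIcc_of_le (by linarith)] at this
  exact this.continuousAt (Icc_mem_nhds (by linarith) (by linarith))

/-- Integration over `[a, b]`, a continuous linear functional on `L²(ℝ)`. -/
def intervalFunctional (a b : ℝ) : L2R →L[ℂ] ℂ :=
  innerSL ℂ (indicatorConstLp 2 (measurableSet_Ioc (a := a) (b := b))
    (by simp [Real.volume_Ioc]) (1 : ℂ))

lemma intervalFunctional_apply {a b : ℝ} (hab : a ≤ b) (f : L2R) :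
    intervalFunctional a b f = ∫ x in a..b, f x := by
  rw [intervalFunctional, innerSL_apply_apply, L2.inner_indicatorConstLp_one,
    intervalIntegral.integral_of_le hab]

/-- The difference quotient is tested against the indicator of [a, b]; translation shifts the
interval, and only the two end pieces survive. -/
lemma tendsto_integral_translation_slope {k g : L2R}
    (h : HasDerivAt (fun t => translation t k) g 0) {a b : ℝ} (hab : a ≤ b) :
    Tendsto (fun t : ℝ => t⁻¹ • ((∫ x in a - t..a, k x) - ∫ x in b - t..b, k x))
      (𝓝[≠] 0) (𝓝 (∫ x in a..b, g x)) := by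
  have h1 := ((intervalFunctional a b).restrictScalars ℝ).hasFDerivAt.comp_hasDerivAt 0 h
  have h2 := h1.tendsto_slope_zero
  have hi : ∀ x y : ℝ, IntervalIntegrable k volume x y := fun x y =>
    intervalIntegrable_of_locallyIntegrable k.locallyIntegrable x y
  have e1 : ((intervalFunctional a b).restrictScalars ℝ) g = ∫ x in a..b, g x :=
    intervalFunctional_apply hab g
  rw [e1] at h2
  refine h2.congr fun t => ?_
  congr 1
  have e2 : ∀ s, (((intervalFunctional a b).restrictScalars ℝ) ∘ fun t => translation t k) s
      = ∫ x in a - s..b - s, k x := by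
    intro s
    have : (((intervalFunctional a b).restrictScalars ℝ) ∘ fun t => translation t k) s
      = ∫ x in a..b, translation s k x := intervalFunctional_apply hab _
    rw [this, ← intervalIntegral.integral_comp_sub_right]
    exact intervalIntegral.integral_congr_ae ((translation_ae s k).mono fun x hx _ => hx)
  rw [e2, e2]
  simp only [zero_add, sub_zero]
  rw [← intervalIntegral.integral_add_adjacent_intervals (hi (a - t) a) (hi a (b - t)),
    ← intervalIntegral.integral_add_adjacent_intervals (hi a (b - t)) (hi (b - t) b)]
  abel

lemma ae_tendsto_average (k : L2R) : ∀ᵐ x : ℝ,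
    Tendsto (fun t : ℝ => t⁻¹ • ∫ v in x - t..x, k v) (𝓝[≠] 0) (𝓝 (k x)) := by
  filter_upwards [LocallyIntegrable.ae_hasDerivAt_integral k.locallyIntegrable] with x hx
  have h1 : HasDerivAt (fun y => ∫ v in x..y, k v) (k x) (x - 0) := by simpa using hx x
  have h2 := (h1.comp_const_sub x 0).neg.tendsto_slope_zero
  rw [neg_neg] at h2
  refine h2.congr fun t => ?_
  congr 1
  simp only [Pi.neg_apply, zero_add, sub_zero, intervalIntegral.integral_same, neg_zero]
  rw [intervalIntegral.integral_symm, neg_neg]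

/-- Functions in the domain of the generator of the translation group are absolutely continuous. -/
lemma exists_isPrimitiveVersion {k l : L2R}
    (h : HasDerivAt (fun t => translation t k) (-(2 * Real.pi * Complex.I) • l) 0) :
    ∃ K, IsPrimitiveVersion k l K := by
  set c : ℂ := 2 * Real.pi * Complex.I with hc
  have hav := ae_tendsto_average k
  have hcl : LocallyIntegrable (fun x => c * l x) := l.locallyIntegrable.smul c
  have hg : (fun x => (-c • l : L2R) x) =ᵐ[volume] fun x => -(c * l x) := by
    filter_upwards [Lp.coeFn_smul (-c) l] with x hx
    rw [hx]; simp
  -- At points of Lebesgue differentiation the end pieces converge to values of k, which gives the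
  -- fundamental theorem of calculus between any two such points.
  have main : ∀ a b : ℝ, a ≤ b →
      Tendsto (fun t : ℝ => t⁻¹ • ∫ v in a - t..a, k v) (𝓝[≠] 0) (𝓝 (k a)) →
      Tendsto (fun t : ℝ => t⁻¹ • ∫ v in b - t..b, k v) (𝓝[≠] 0) (𝓝 (k b)) →
      k b - k a = ∫ x in a..b, c * l x := by
    intro a b hab ha hb
    have h1 := tendsto_integral_translation_slope h hab
    have h2 := (ha.sub hb)
    simp only [← smul_sub] at h2
    have h3 := tendsto_nhds_unique h2 h1
    rw [intervalIntegral.integral_congr_ae (hg.mono fun x hx _ => hx),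
      intervalIntegral.integral_neg] at h3
    rw [← neg_sub, h3, neg_neg]
  obtain ⟨a, ha⟩ := hav.exists
  refine ⟨fun x => k a + ∫ v in a..x, c * l v, ?_,
    absolutelyContinuousOnInterval_primitive hcl _ _, ?_⟩
  · filter_upwards [hav] with x hx
    rcases le_total a x with hax | hax
    · rw [← main a x hax ha hx]; ring
    · rw [intervalIntegral.integral_symm, ← main x a hax hx ha]; ring
  · filter_upwards [LocallyIntegrable.ae_hasDerivAt_integral hcl] with x hx
    exact (hx a).const_add _

end AbsolutelyContinuous

/-! ### The feedback equation, scattering at the vertex, and the isometric wave map. -/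

section WaveMap

open Filter Topology

/-- Multiplication by the indicator function of `s` on `L²(ℝ)`. -/
def cutoff (s : Set ℝ) (hs : MeasurableSet s) : L2R →L[ℂ] L2R :=
  LinearMap.mkContinuous
    { toFun := fun f => ((Lp.memLp f).indicator hs).toLp _
      map_add' := fun f g => by
        apply Lp.ext
        filter_upwards [((Lp.memLp (f + g)).indicator hs).coeFn_toLp,
          Lp.coeFn_add (((Lp.memLp f).indicator hs).toLp _) (((Lp.memLp g).indicator hs).toLp _),
          ((Lp.memLp f).indicator hs).coeFn_toLp, ((Lp.memLp g).indicator hs).coeFn_toLp,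
          Lp.coeFn_add f g] with x h1 h2 h3 h4 h5
        rw [h1, h2, Pi.add_apply, h3, h4]
        by_cases hx : x ∈ s
        · simp only [indicator_of_mem hx, h5, Pi.add_apply]
        · simp [hx]
      map_smul' := fun c f => by
        apply Lp.ext
        filter_upwards [((Lp.memLp (c • f)).indicator hs).coeFn_toLp,
          Lp.coeFn_smul c (((Lp.memLp f).indicator hs).toLp _),
          ((Lp.memLp f).indicator hs).coeFn_toLp, Lp.coeFn_smul c f] with x h1 h2 h3 h5
        rw [h1, RingHom.id_apply, h2, Pi.smul_apply, h3]
        by_cases hx : x ∈ s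
        · simp only [indicator_of_mem hx, h5, Pi.smul_apply]
        · simp [hx] } 1 fun f => by
      rw [one_mul]
      refine Lp.norm_le_norm_of_ae_le ?_
      filter_upwards [((Lp.memLp f).indicator hs).coeFn_toLp] with x h1
      simp only [LinearMap.coe_mk, AddHom.coe_mk]
      rw [h1]
      exact norm_indicator_le_norm_self _ _

lemma cutoff_ae {s : Set ℝ} (hs : MeasurableSet s) (f : L2R) :
    cutoff s hs f =ᵐ[volume] s.indicator f :=
  ((Lp.memLp f).indicator hs).coeFn_toLp

lemma eq_zero_of_norm_le_mul_translation {c : ℝ} (hc : c < 1) (t : ℝ) {z : L2R}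
    (h : ∀ᵐ x, ‖z x‖ ≤ c * ‖z (x - t)‖) : z = 0 := by
  have h1 : ‖z‖ ≤ c * ‖translation t z‖ := by
    refine Lp.norm_le_mul_norm_of_ae_le_mul ?_
    filter_upwards [h, translation_ae t z] with x h1 h2
    rwa [h2]
  rw [LinearIsometryEquiv.norm_map] at h1
  have : ‖z‖ = 0 := by nlinarith [norm_nonneg z]
  exact norm_eq_zero.1 this

/-- The solution operator `k ↦ h` of the feedback equation `h = k + q h(· - t)`, for `|q| < 1`. -/
def feedback (q : ℂ) (t : ℝ) : L2R →L[ℂ] L2R :=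
  Ring.inverse (1 - q • (translation t).toContinuousLinearEquiv.toContinuousLinearMap)

lemma feedback_eq {q : ℂ} (hq : ‖q‖ < 1) (t : ℝ) (k : L2R) :
    feedback q t k = k + q • translation t (feedback q t k) := by
  set T : L2R →L[ℂ] L2R := q • (translation t).toContinuousLinearEquiv.toContinuousLinearMap with hT
  -- Contractivity makes `1 - T` a unit, so that `Ring.inverse` is a true inverse and not its
  -- default value 0.
  have hT1 : ‖T‖ < 1 := by
    refine lt_of_le_of_lt (ContinuousLinearMap.opNorm_le_bound _ (norm_nonneg q) fun f => ?_) hq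
    simp [hT, norm_smul]
  have h1 := Ring.mul_inverse_cancel (1 - T) (isUnit_one_sub_of_norm_lt_one hT1)
  have h2 := congrArg (fun S : L2R →L[ℂ] L2R => S k) h1
  simp only [sub_mul, one_mul, sub_apply, mul_apply_eq_comp,
    one_apply_eq_self] at h2
  exact sub_eq_iff_eq_add.1 h2

lemma feedback_unique {q : ℂ} (hq : ‖q‖ < 1) (t : ℝ) {k h : L2R}
    (hh : h = k + q • translation t h) : h = feedback q t k := by
  rw [← sub_eq_zero]
  set z := h - feedback q t k with hz
  have h1 : z = q • translation t z := by
    conv_lhs => rw [hz, hh, feedback_eq hq]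
    rw [hz, map_sub, smul_sub]; abel
  have h2 : ‖z‖ = ‖q‖ * ‖z‖ := by
    conv_lhs => rw [h1, norm_smul, LinearIsometryEquiv.norm_map]
  have : ‖z‖ = 0 := by nlinarith [norm_nonneg z]
  exact norm_eq_zero.1 this

/-- The translate of a solution solves the equation with translated input; uniqueness concludes. -/
lemma feedback_translation {q : ℂ} (hq : ‖q‖ < 1) (s t : ℝ) (k : L2R) :
    feedback q t (translation s k) = translation s (feedback q t k) := by
  refine (feedback_unique hq t ?_).symm
  conv_lhs => rw [feedback_eq hq]
  rw [map_add, map_smul, translation_comm]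

lemma feedback_ae {q : ℂ} (hq : ‖q‖ < 1) (t : ℝ) (k : L2R) :
    ∀ᵐ x, feedback q t k x = k x + q * feedback q t k (x - t) := by
  have h := feedback_eq hq t k
  filter_upwards [Lp.coeFn_add k (q • translation t (feedback q t k)),
    Lp.coeFn_smul q (translation t (feedback q t k)), translation_ae t (feedback q t k)]
    with x h1 h2 h3
  conv_lhs => rw [h, h1, Pi.add_apply, h2, Pi.smul_apply, h3]
  rfl

section Unitary

variable (B : Matrix.unitaryGroup (Fin 2) ℂ)

/-- The entries of `B* B = 1` and `B B* = 1` serve as coefficients for `linear_combination` later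
on. -/
lemma unitary_col_zero : starRingEnd ℂ (B.1 0 0) * B.1 0 0 + starRingEnd ℂ (B.1 1 0) * B.1 1 0
    = 1 := by
  have h := congrFun (congrFun (Matrix.mem_unitaryGroup_iff'.1 B.2) 0) 0
  simpa [Matrix.mul_apply, Fin.sum_univ_two, Matrix.star_apply] using h

lemma unitary_col_one : starRingEnd ℂ (B.1 0 1) * B.1 0 1 + starRingEnd ℂ (B.1 1 1) * B.1 1 1
    = 1 := by
  have h := congrFun (congrFun (Matrix.mem_unitaryGroup_iff'.1 B.2) 1) 1
  simpa [Matrix.mul_apply, Fin.sum_univ_two, Matrix.star_apply] using h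

lemma unitary_cols : starRingEnd ℂ (B.1 0 0) * B.1 0 1 + starRingEnd ℂ (B.1 1 0) * B.1 1 1
    = 0 := by
  have h := congrFun (congrFun (Matrix.mem_unitaryGroup_iff'.1 B.2) 0) 1
  simpa [Matrix.mul_apply, Fin.sum_univ_two, Matrix.star_apply] using h

lemma unitary_cols' : starRingEnd ℂ (B.1 0 1) * B.1 0 0 + starRingEnd ℂ (B.1 1 1) * B.1 1 0
    = 0 := by
  have h := congrFun (congrFun (Matrix.mem_unitaryGroup_iff'.1 B.2) 1) 0
  simpa [Matrix.mul_apply, Fin.sum_univ_two, Matrix.star_apply] using h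

lemma unitary_row_zero : B.1 0 0 * starRingEnd ℂ (B.1 0 0) + B.1 0 1 * starRingEnd ℂ (B.1 0 1)
    = 1 := by
  have h := congrFun (congrFun (Matrix.mem_unitaryGroup_iff.1 B.2) 0) 0
  simpa [Matrix.mul_apply, Fin.sum_univ_two, Matrix.star_apply] using h

lemma unitary_row_one : B.1 1 0 * starRingEnd ℂ (B.1 1 0) + B.1 1 1 * starRingEnd ℂ (B.1 1 1)
    = 1 := by
  have h := congrFun (congrFun (Matrix.mem_unitaryGroup_iff.1 B.2) 1) 1
  simpa [Matrix.mul_apply, Fin.sum_univ_two, Matrix.star_apply] using h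

lemma unitary_rows : B.1 0 0 * starRingEnd ℂ (B.1 1 0) + B.1 0 1 * starRingEnd ℂ (B.1 1 1)
    = 0 := by
  have h := congrFun (congrFun (Matrix.mem_unitaryGroup_iff.1 B.2) 0) 1
  simpa [Matrix.mul_apply, Fin.sum_univ_two, Matrix.star_apply] using h

lemma unitary_rows' : B.1 1 0 * starRingEnd ℂ (B.1 0 0) + B.1 1 1 * starRingEnd ℂ (B.1 0 1)
    = 0 := by
  have h := congrFun (congrFun (Matrix.mem_unitaryGroup_iff.1 B.2) 1) 0
  simpa [Matrix.mul_apply, Fin.sum_univ_two, Matrix.star_apply] using h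

/-- Since |B₀₀|² + |B₁₀|² = 1, a positive w makes the loop lossy; the solvability of the feedback
equation rests on this. -/
lemma norm_entry_lt_one {B : Matrix.unitaryGroup (Fin 2) ℂ} (hw : 0 < wParam B) :
    ‖B.1 1 0‖ < 1 := by
  have h := unitary_col_zero B
  rw [← Complex.normSq_eq_conj_mul_self, ← Complex.normSq_eq_conj_mul_self, ← Complex.ofReal_add,
    ← Complex.ofReal_one, Complex.ofReal_inj, Complex.normSq_eq_norm_sq,
    Complex.normSq_eq_norm_sq] at h
  have hw' : 0 < ‖B.1 0 0‖ := hw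
  nlinarith [norm_nonneg (B.1 1 0)]

lemma norm_conj_entry_lt_one {B : Matrix.unitaryGroup (Fin 2) ℂ} (hw : 0 < wParam B) :
    ‖starRingEnd ℂ (B.1 1 0)‖ < 1 := by
  rw [Complex.norm_conj]; exact norm_entry_lt_one hw

/-- Conservation of the norm at the vertex: `(h, o) = B* (k, l)` has the norm of `(k, l)`. -/
lemma norm_sq_scattering (k l : ℂ) :
    ‖starRingEnd ℂ (B.1 0 0) * k + starRingEnd ℂ (B.1 1 0) * l‖ ^ 2 +
      ‖starRingEnd ℂ (B.1 0 1) * k + starRingEnd ℂ (B.1 1 1) * l‖ ^ 2 = ‖k‖ ^ 2 + ‖l‖ ^ 2 := by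
  have : ∀ z : ℂ, ((‖z‖ ^ 2 : ℝ) : ℂ) = z * starRingEnd ℂ z := fun z => by
    rw [Complex.mul_conj, Complex.normSq_eq_norm_sq]
  rw [← Complex.ofReal_inj, Complex.ofReal_add, Complex.ofReal_add, this, this, this, this]
  simp only [map_add, map_mul, Complex.conj_conj]
  linear_combination (k * starRingEnd ℂ k) * unitary_row_zero B +
    (l * starRingEnd ℂ l) * unitary_row_one B +
    (l * starRingEnd ℂ k) * unitary_rows B + (k * starRingEnd ℂ l) * unitary_rows' B

end Unitary

variable (α β : ℝ) (B : Matrix.unitaryGroup (Fin 2) ℂ)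

/-- The wave in the bounded component generated by an incoming wave `k`; the coordinate is the
distance to the left end point. -/
def loopWave : L2R →L[ℂ] L2R :=
  starRingEnd ℂ (B.1 0 0) • feedback (starRingEnd ℂ (B.1 1 0)) (-(α - 1))

/-- The outgoing wave generated by an incoming wave `k`. -/
def outWave : L2R →L[ℂ] L2R :=
  starRingEnd ℂ (B.1 0 1) • ContinuousLinearMap.id ℂ L2R + starRingEnd ℂ (B.1 1 1) •
    ((translation (-(α - 1))).toContinuousLinearEquiv.toContinuousLinearMap ∘L loopWave α B)

/-- The state in `L²(Ω)` generated by an incoming wave. -/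
def waveMap : L2R →L[ℂ] L2Omega α β :=
  LpToLpRestrictCLM ℝ ℂ ℂ volume 2 (Omega α β) ∘L
    (cutoff (Iio 0) measurableSet_Iio +
      cutoff (Ioo 1 α) measurableSet_Ioo ∘L
        (translation 1).toContinuousLinearEquiv.toContinuousLinearMap ∘L loopWave α B +
      cutoff (Ioi β) measurableSet_Ioi ∘L
        (translation β).toContinuousLinearEquiv.toContinuousLinearMap ∘L outWave α B)

variable {α β B}

/-- The vertex condition along an orbit: the part of the wave at coordinate `x + (α - 1)` reaches α
at the moment when the part at x is at 1. -/
lemma loopWave_ae (hw : 0 < wParam B) (k : L2R) :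
    ∀ᵐ x, loopWave α B k x = starRingEnd ℂ (B.1 0 0) * k x
      + starRingEnd ℂ (B.1 1 0) * loopWave α B k (x + (α - 1)) := by
  have h1 : loopWave α B k =ᵐ[volume] fun x => starRingEnd ℂ (B.1 0 0) *
      feedback (starRingEnd ℂ (B.1 1 0)) (-(α - 1)) k x := Lp.coeFn_smul _ _
  filter_upwards [h1, ae_comp_add h1 (α - 1),
    feedback_ae (norm_conj_entry_lt_one hw) (-(α - 1)) k] with x h1 h2 h3
  rw [h1, h2, h3, sub_neg_eq_add]; ring

lemma outWave_ae (k : L2R) :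
    ∀ᵐ x, outWave α B k x = starRingEnd ℂ (B.1 0 1) * k x
      + starRingEnd ℂ (B.1 1 1) * loopWave α B k (x + (α - 1)) := by
  have h0 : outWave α B k = starRingEnd ℂ (B.1 0 1) • k +
    starRingEnd ℂ (B.1 1 1) • translation (-(α - 1)) (loopWave α B k) := rfl
  filter_upwards [Lp.coeFn_add (starRingEnd ℂ (B.1 0 1) • k)
    (starRingEnd ℂ (B.1 1 1) • translation (-(α - 1)) (loopWave α B k)),
    Lp.coeFn_smul (starRingEnd ℂ (B.1 0 1)) k,
    Lp.coeFn_smul (starRingEnd ℂ (B.1 1 1)) (translation (-(α - 1)) (loopWave α B k)),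
    translation_ae (-(α - 1)) (loopWave α B k)] with x h1 h2 h3 h4
  rw [h0, h1, Pi.add_apply, h2, h3, Pi.smul_apply, Pi.smul_apply, h4, sub_neg_eq_add]
  rfl

lemma loopWave_translation (hw : 0 < wParam B) (t : ℝ) (k : L2R) :
    loopWave α B (translation t k) = translation t (loopWave α B k) := by
  simp only [loopWave, smul_apply, map_smul,
    feedback_translation (norm_conj_entry_lt_one hw)]

lemma outWave_translation (hw : 0 < wParam B) (t : ℝ) (k : L2R) :
    outWave α B (translation t k) = translation t (outWave α B k) := by
  have h0 : ∀ k, outWave α B k = starRingEnd ℂ (B.1 0 1) • k +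
    starRingEnd ℂ (B.1 1 1) • translation (-(α - 1)) (loopWave α B k) := fun _ => rfl
  rw [h0, h0, map_add, map_smul, map_smul, loopWave_translation hw, translation_comm]

lemma ae_omega_iff {P : ℝ → Prop} :
    (∀ᵐ x ∂(volume.restrict (Omega α β)), P x) ↔ ∀ᵐ x, x ∈ Omega α β → P x :=
  ae_restrict_iff' (isOpen_Omega α β).measurableSet

lemma waveMap_ae (hα : 1 < α) (hαβ : α < β) (k : L2R) :
    ∀ᵐ x, (x < 0 → waveMap α β B k x = k x) ∧
      (x ∈ Ioo 1 α → waveMap α β B k x = loopWave α B k (x - 1)) ∧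
      (β < x → waveMap α β B k x = outWave α B k (x - β)) := by
  set c₁ := cutoff (Iio 0) measurableSet_Iio k
  set c₂ := cutoff (Ioo 1 α) measurableSet_Ioo (translation 1 (loopWave α B k))
  set c₃ := cutoff (Ioi β) measurableSet_Ioi (translation β (outWave α B k))
  have h0 : waveMap α β B k =ᵐ[volume.restrict (Omega α β)] (c₁ + c₂ + c₃ : L2R) :=
    LpToLpRestrictCLM_coeFn ℂ (Omega α β) (c₁ + c₂ + c₃ : L2R)
  filter_upwards [ae_omega_iff.1 h0, Lp.coeFn_add (c₁ + c₂) c₃, Lp.coeFn_add c₁ c₂,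
    cutoff_ae measurableSet_Iio k, cutoff_ae measurableSet_Ioo (translation 1 (loopWave α B k)),
    cutoff_ae measurableSet_Ioi (translation β (outWave α B k)),
    translation_ae 1 (loopWave α B k), translation_ae β (outWave α B k)]
    with x h0 h1 h2 h3 h4 h5 h6 h7
  rw [h1, Pi.add_apply, h2, Pi.add_apply, h3, h4, h5] at h0
  refine ⟨fun hx => ?_, fun hx => ?_, fun hx => ?_⟩
  · rw [h0 (Or.inl (Or.inl hx)), indicator_of_mem (show x ∈ Iio 0 from hx),
      indicator_of_notMem (fun h => by linarith [h.1]),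
      indicator_of_notMem (show x ∉ Ioi β from fun h : β < x => by linarith)]
    simp
  · rw [h0 (Or.inl (Or.inr hx)), indicator_of_notMem (show x ∉ Iio 0 from fun h : x < 0 => by linarith [hx.1]),
      indicator_of_mem hx, indicator_of_notMem (show x ∉ Ioi β from fun h : β < x => by linarith [hx.2]), h6]
    simp
  · rw [h0 (Or.inr hx), indicator_of_notMem (show x ∉ Iio 0 from fun h : x < 0 => by linarith),
      indicator_of_notMem (fun h => by linarith [h.2]), indicator_of_mem (show x ∈ Ioi β from hx),
      h7]
    simp

lemma norm_sq_eq_integral {X : Type*} [MeasurableSpace X] {μ : Measure X} (f : Lp ℂ 2 μ) :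
    ‖f‖ ^ 2 = ∫ x, ‖f x‖ ^ 2 ∂μ := by
  have h : ((‖f‖ ^ 2 : ℝ) : ℂ) = inner ℂ f f := by
    rw [inner_self_eq_norm_sq_to_K]; norm_cast
  rw [L2.inner_def] at h
  have h2 : ∀ x, inner ℂ (f x) (f x) = ((‖f x‖ ^ 2 : ℝ) : ℂ) := fun x => by
    rw [inner_self_eq_norm_sq_to_K]; norm_cast
  simp only [h2] at h
  rw [integral_complex_ofReal] at h
  exact_mod_cast h

lemma integrable_norm_sq {X : Type*} [MeasurableSpace X] {μ : Measure X} (f : Lp ℂ 2 μ) :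
    Integrable (fun x => ‖f x‖ ^ 2) μ :=
  (memLp_two_iff_integrable_sq_norm (Lp.aestronglyMeasurable f)).1 (Lp.memLp f)

lemma setIntegral_comp_sub (u : ℝ → ℝ) (s : Set ℝ) (t : ℝ) :
    ∫ x in (· - t) ⁻¹' s, u (x - t) = ∫ x in s, u x :=
  (measurePreserving_sub_right volume t).setIntegral_preimage_emb
    (MeasurableEquiv.subRight t).measurableEmbedding u s

lemma setIntegral_omega (hα : 1 < α) (hαβ : α < β) {u : ℝ → ℝ}
    (hi : IntegrableOn u (Omega α β)) :
    ∫ x in Omega α β, u x = (∫ x in Iio 0, u x) + (∫ x in Ioo 1 α, u x) + ∫ x in Ioi β, u x := by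
  unfold Omega at hi ⊢
  rw [setIntegral_union _ measurableSet_Ioi
    (hi.mono_set subset_union_left) (hi.mono_set subset_union_right),
    setIntegral_union _ measurableSet_Ioo
    (hi.mono_set (subset_union_left.trans subset_union_left))
    (hi.mono_set (subset_union_right.trans subset_union_left))]
  · rw [Set.disjoint_left]; intro x (hx : x < 0) hx'; linarith [hx'.1]
  · rw [Set.disjoint_left]; rintro x ((hx : x < 0) | hx) (hx' : β < x)
    · linarith
    · linarith [hx.2]

lemma norm_sq_eq_omega (hα : 1 < α) (hαβ : α < β) (f : L2Omega α β) :
    ‖f‖ ^ 2 = (∫ x in Iio 0, ‖f x‖ ^ 2) + (∫ x in Ioo 1 α, ‖f x‖ ^ 2)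
      + ∫ x in Ioi β, ‖f x‖ ^ 2 := by
  rw [norm_sq_eq_integral, setIntegral_omega hα hαβ (integrable_norm_sq f)]

/-- Pointwise, |h|² + |o|² = |k|² + |h(· + α - 1)|². Integrated over (0, ∞), the tail of h beyond α
- 1 cancels: the energy in the loop and beyond β is exactly that of k on (0, ∞). -/
lemma norm_waveMap (hα : 1 < α) (hαβ : α < β) (hw : 0 < wParam B) (k : L2R) :
    ‖waveMap α β B k‖ = ‖k‖ := by
  set h := loopWave α B k with hh
  set o := outWave α B k with ho
  have hV := waveMap_ae (B := B) hα hαβ k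
  have e1 : ∫ x in Iio 0, ‖waveMap α β B k x‖ ^ 2 = ∫ x in Iio 0, ‖k x‖ ^ 2 :=
    setIntegral_congr_ae measurableSet_Iio (hV.mono fun x hx hx' => by rw [hx.1 hx'])
  have e2 : ∫ x in Ioo 1 α, ‖waveMap α β B k x‖ ^ 2 = ∫ x in Ioo 0 (α - 1), ‖h x‖ ^ 2 := by
    rw [setIntegral_congr_ae measurableSet_Ioo (hV.mono fun x hx hx' => by rw [hx.2.1 hx'])]
    have := setIntegral_comp_sub (fun x => ‖h x‖ ^ 2) (Ioo 0 (α - 1)) 1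
    rw [← this]; simp [hh]
  have e3 : ∫ x in Ioi β, ‖waveMap α β B k x‖ ^ 2 = ∫ x in Ioi 0, ‖o x‖ ^ 2 := by
    rw [setIntegral_congr_ae measurableSet_Ioi (hV.mono fun x hx hx' => by rw [hx.2.2 hx'])]
    have := setIntegral_comp_sub (fun x => ‖o x‖ ^ 2) (Ioi 0) β
    rw [← this]; simp [ho]
  have hpt : ∀ᵐ x, ‖h x‖ ^ 2 + ‖o x‖ ^ 2 = ‖k x‖ ^ 2 + ‖h (x + (α - 1))‖ ^ 2 := by
    filter_upwards [loopWave_ae (α := α) hw k, outWave_ae (α := α) (B := B) k] with x h1 h2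
    rw [hh, ho, h2]
    nth_rewrite 1 [h1]
    exact norm_sq_scattering B _ _
  have ik := integrable_norm_sq k
  have ih := integrable_norm_sq h
  have io := integrable_norm_sq o
  have ih' : Integrable fun x => ‖h (x + (α - 1))‖ ^ 2 := ih.comp_add_right (α - 1)
  have e4 : (∫ x in Ioi 0, ‖h x‖ ^ 2) + (∫ x in Ioi 0, ‖o x‖ ^ 2)
      = (∫ x in Ioi 0, ‖k x‖ ^ 2) + ∫ x in Ioi (α - 1), ‖h x‖ ^ 2 := by
    have h5 : ∫ x in Ioi 0, ‖h (x + (α - 1))‖ ^ 2 = ∫ x in Ioi (α - 1), ‖h x‖ ^ 2 := by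
      have := setIntegral_comp_sub (fun x => ‖h x‖ ^ 2) (Ioi (α - 1)) (-(α - 1))
      rw [← this]
      simp only [sub_neg_eq_add, preimage_add_const_Ioi, sub_self]
    rw [← h5, ← integral_add ih.integrableOn io.integrableOn,
      ← integral_add ik.integrableOn ih'.integrableOn]
    exact setIntegral_congr_ae measurableSet_Ioi (hpt.mono fun x hx _ => hx)
  have e5 : ∫ x in Ioi 0, ‖h x‖ ^ 2
      = (∫ x in Ioo 0 (α - 1), ‖h x‖ ^ 2) + ∫ x in Ioi (α - 1), ‖h x‖ ^ 2 := by
    rw [← integral_Ioc_eq_integral_Ioo, ← setIntegral_union _ measurableSet_Ioi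
      ih.integrableOn ih.integrableOn, Ioc_union_Ioi_eq_Ioi (by linarith)]
    exact Ioc_disjoint_Ioi le_rfl
  have e6 : ∫ x, ‖k x‖ ^ 2 = (∫ x in Iio 0, ‖k x‖ ^ 2) + ∫ x in Ioi 0, ‖k x‖ ^ 2 := by
    rw [← integral_Ici_eq_integral_Ioi, ← setIntegral_union _ measurableSet_Ici
      ik.integrableOn ik.integrableOn, Iio_union_Ici, setIntegral_univ]
    rw [Set.disjoint_left]; intro x (hx : x < 0) (hx' : 0 ≤ x); linarith
  have : ‖waveMap α β B k‖ ^ 2 = ‖k‖ ^ 2 := by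
    rw [norm_sq_eq_omega hα hαβ, norm_sq_eq_integral k, e1, e2, e3, e6]
    linarith
  exact (sq_eq_sq₀ (norm_nonneg _) (norm_nonneg _)).1 this

end WaveMap

/-! ### Reconstruction of the incoming wave, and the unitary group. -/

section Surjective

open Filter Topology

variable {α β : ℝ} {B : Matrix.unitaryGroup (Fin 2) ℂ}

/-- Extension by zero of a function in `L²(Ω)`. -/
lemma exists_extension (f : L2Omega α β) :
    ∃ g : L2R, ∀ᵐ x, x ∈ Omega α β → g x = f x := by
  have hm : MemLp ((Omega α β).indicator f) 2 volume :=
    (memLp_indicator_iff_restrict (isOpen_Omega α β).measurableSet).2 (Lp.memLp f)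
  refine ⟨hm.toLp _, ?_⟩
  filter_upwards [hm.coeFn_toLp] with x hx hx'
  rw [hx, indicator_of_mem hx']

lemma cutoff_translation_ae {s : Set ℝ} (hs : MeasurableSet s) (t : ℝ) (f : L2R) :
    ∀ᵐ x, cutoff s hs (translation t f) x = s.indicator (fun x => f (x - t)) x := by
  filter_upwards [cutoff_ae hs (translation t f), translation_ae t f] with x h1 h2
  rw [h1]
  by_cases hx : x ∈ s
  · simp only [indicator_of_mem hx, h2]
  · simp only [indicator_of_notMem hx]

/-- The scattering is inverted with `(k, h(· + α - 1)) = B (h, o)`: the state prescribes o on (0, ∞)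
and h on (0, α - 1), the second row continues h to the right, and the first row then yields k. -/
lemma waveMap_surjective (hα : 1 < α) (hαβ : α < β) (hw : 0 < wParam B) :
    Function.Surjective (waveMap α β B) := by
  intro f
  obtain ⟨g, hg⟩ := exists_extension f
  have hq := norm_entry_lt_one hw
  have hL : 0 < α - 1 := by linarith
  set o : L2R := cutoff (Ioi 0) measurableSet_Ioi (translation (-β) g) with ho
  set u : L2R := cutoff (Ioo 0 (α - 1)) measurableSet_Ioo (translation (-1) g) with hu
  -- The continuation to the right is again a feedback equation with a contraction, now for
  -- translation by +(α - 1); u supplies the first loop.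
  set h : L2R := feedback (B.1 1 0) (α - 1) (u + B.1 1 1 • translation (α - 1) o) with hh
  set k₁ : L2R := cutoff (Ioi 0) measurableSet_Ioi (B.1 0 0 • h + B.1 0 1 • o) with hk₁
  set k : L2R := cutoff (Iio 0) measurableSet_Iio g + k₁ with hk
  have ho' : ∀ᵐ x, o x = (Ioi 0).indicator (fun x => g (x + β)) x := by
    simpa using cutoff_translation_ae measurableSet_Ioi (-β) g
  have hu' : ∀ᵐ x, u x = (Ioo 0 (α - 1)).indicator (fun x => g (x + 1)) x := by
    simpa using cutoff_translation_ae measurableSet_Ioo (-1) g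
  have hh' : ∀ᵐ x, h x = u x + B.1 1 1 * o (x - (α - 1)) + B.1 1 0 * h (x - (α - 1)) := by
    filter_upwards [feedback_ae hq (α - 1) (u + B.1 1 1 • translation (α - 1) o),
      Lp.coeFn_add u (B.1 1 1 • translation (α - 1) o),
      Lp.coeFn_smul (B.1 1 1) (translation (α - 1) o), translation_ae (α - 1) o] with x h1 h2 h3 h4
    rw [hh, h1, h2, Pi.add_apply, h3, Pi.smul_apply, h4, smul_eq_mul]
  have hk' : ∀ᵐ x, (x < 0 → k x = g x) ∧ (0 < x → k x = B.1 0 0 * h x + B.1 0 1 * o x) := by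
    filter_upwards [Lp.coeFn_add (cutoff (Iio 0) measurableSet_Iio g) k₁,
      cutoff_ae measurableSet_Iio g, cutoff_ae measurableSet_Ioi (B.1 0 0 • h + B.1 0 1 • o),
      Lp.coeFn_add (B.1 0 0 • h) (B.1 0 1 • o), Lp.coeFn_smul (B.1 0 0) h,
      Lp.coeFn_smul (B.1 0 1) o] with x h1 h2 h3 h4 h5 h6
    rw [hk, h1, Pi.add_apply, h2, hk₁, h3]
    refine ⟨fun hx => ?_, fun hx => ?_⟩
    · rw [indicator_of_mem (show x ∈ Iio 0 from hx),
        indicator_of_notMem (show x ∉ Ioi 0 from fun h : 0 < x => by linarith), add_zero]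
    · rw [indicator_of_notMem (show x ∉ Iio 0 from fun h : x < 0 => by linarith),
        indicator_of_mem (show x ∈ Ioi 0 from hx), h4, Pi.add_apply, h5, h6, zero_add]
      rfl
  -- For x ≤ 0 the sources vanish, so the restricted h is dominated by |B₁₀| times its own
  -- translate.
  have hneg : ∀ᵐ x, x ≤ 0 → h x = 0 := by
    have hz : cutoff (Iic 0) measurableSet_Iic h = 0 := by
      refine eq_zero_of_norm_le_mul_translation hq (α - 1) ?_
      have hc := cutoff_ae (measurableSet_Iic (a := (0 : ℝ))) h
      filter_upwards [hc, ae_comp_sub hc (α - 1), hh', hu', ae_comp_sub ho' (α - 1)]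
        with x h1 h2 h3 h4 h5
      rw [h1, h2]
      by_cases hx : x ∈ Iic 0
      · have hx0 : x ≤ 0 := hx
        rw [indicator_of_notMem (fun h => by linarith [h.1])] at h4
        rw [indicator_of_notMem (show x - (α - 1) ∉ Ioi 0 from fun h : 0 < x - (α - 1) => by
          linarith)] at h5
        rw [indicator_of_mem hx, indicator_of_mem (show x - (α - 1) ∈ Iic 0 from mem_Iic.2 (by linarith)), h3, h4, h5]
        simp
      · rw [indicator_of_notMem hx, norm_zero]; positivity
    have hz' : (cutoff (Iic 0) measurableSet_Iic h : ℝ → ℂ) =ᵐ[volume] 0 := by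
      rw [hz]; exact Lp.coeFn_zero _ _ _
    filter_upwards [cutoff_ae measurableSet_Iic h, hz'] with x h1 h2 hx
    rw [h2, indicator_of_mem (show x ∈ Iic 0 from hx)] at h1
    exact h1.symm
  have hmid : ∀ᵐ x, x ∈ Ioo 0 (α - 1) → h x = g (x + 1) := by
    filter_upwards [hh', hu', ae_comp_sub ho' (α - 1), ae_comp_sub hneg (α - 1)]
      with x h1 h2 h3 h4 hx
    rw [h1, h2, h3, h4 (by linarith [hx.2]), indicator_of_mem hx,
      indicator_of_notMem (show x - (α - 1) ∉ Ioi 0 from fun h : 0 < x - (α - 1) => by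
          linarith [hx.2])]
    simp
  have hstep : ∀ᵐ x, 0 < x → h (x + (α - 1)) = B.1 1 0 * h x + B.1 1 1 * o x := by
    filter_upwards [ae_comp_add hh' (α - 1), ae_comp_add hu' (α - 1)] with x h1 h2 hx
    rw [h1, h2, indicator_of_notMem (fun h => by linarith [h.2]), add_sub_cancel_right]
    ring
  -- By `B* B = 1`, h also solves the loop equation on x > 0. As `x + (α - 1)` remains positive, the
  -- difference from the loop wave is contracted to 0.
  have hloop : ∀ᵐ x, 0 < x → loopWave α B k x = h x := by
    have hz : cutoff (Ioi 0) measurableSet_Ioi (loopWave α B k - h) = 0 := by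
      refine eq_zero_of_norm_le_mul_translation hq (-(α - 1)) ?_
      have hc : ∀ᵐ x, cutoff (Ioi 0) measurableSet_Ioi (loopWave α B k - h) x
          = (Ioi 0).indicator (fun x => loopWave α B k x - h x) x := by
        filter_upwards [cutoff_ae measurableSet_Ioi (loopWave α B k - h),
          Lp.coeFn_sub (loopWave α B k) h] with x h1 h2
        rw [h1]
        by_cases hx : x ∈ Ioi 0
        · simp only [indicator_of_mem hx, h2, Pi.sub_apply]
        · simp only [indicator_of_notMem hx]
      filter_upwards [hc, ae_comp_add hc (α - 1), loopWave_ae (α := α) hw k, hk', hstep]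
        with x h1 h2 h3 h4 h5
      rw [sub_neg_eq_add, h1, h2]
      by_cases hx : x ∈ Ioi 0
      · have hx0 : 0 < x := hx
        rw [indicator_of_mem hx, indicator_of_mem (show x + (α - 1) ∈ Ioi 0 from mem_Ioi.2 (by linarith)), h3, h5 hx0,
          h4.2 hx0, ← Complex.norm_conj (B.1 1 0), ← norm_mul]
        refine le_of_eq (congrArg norm ?_)
        linear_combination h x * unitary_col_zero B + o x * unitary_cols B
      · rw [indicator_of_notMem hx, norm_zero]; positivity
    have hz' : (cutoff (Ioi 0) measurableSet_Ioi (loopWave α B k - h) : ℝ → ℂ) =ᵐ[volume] 0 := by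
      rw [hz]; exact Lp.coeFn_zero _ _ _
    filter_upwards [cutoff_ae measurableSet_Ioi (loopWave α B k - h), hz',
      Lp.coeFn_sub (loopWave α B k) h] with x h1 h2 h3 hx
    rw [h2, indicator_of_mem (show x ∈ Ioi 0 from hx), h3] at h1
    exact sub_eq_zero.1 h1.symm
  have hout : ∀ᵐ x, 0 < x → outWave α B k x = g (x + β) := by
    filter_upwards [outWave_ae (α := α) (B := B) k, ae_comp_add hloop (α - 1), hk', hstep, ho']
      with x h1 h2 h3 h4 h5 hx
    rw [indicator_of_mem (show x ∈ Ioi 0 from hx)] at h5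
    rw [h1, h2 (by linarith), h4 hx, h3.2 hx, ← h5]
    linear_combination h x * unitary_cols' B + o x * unitary_col_one B
  refine ⟨k, Lp.ext ?_⟩
  rw [EventuallyEq, ae_omega_iff]
  filter_upwards [waveMap_ae (B := B) hα hαβ k, hg, hk', ae_comp_sub hloop 1, ae_comp_sub hmid 1,
    ae_comp_sub hout β] with x h1 h2 h3 h4 h5 h6 hx
  rw [← h2 hx]
  rcases hx with (hx | hx) | hx
  · rw [h1.1 hx, h3.1 hx]
  · rw [h1.2.1 hx, h4 (by linarith [hx.1]), h5 ⟨by linarith [hx.1], by linarith [hx.2]⟩,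
      sub_add_cancel]
  · rw [h1.2.2 hx, h6 (sub_pos.2 hx), sub_add_cancel]

/-- The wave map as a unitary operator. -/
def waveEquiv (hα : 1 < α) (hαβ : α < β) (hw : 0 < wParam B) : L2R ≃ₗᵢ[ℂ] L2Omega α β :=
  LinearIsometryEquiv.ofSurjective ⟨(waveMap α β B).toLinearMap, norm_waveMap hα hαβ hw⟩
    (waveMap_surjective hα hαβ hw)

lemma waveEquiv_apply (hα : 1 < α) (hαβ : α < β) (hw : 0 < wParam B) (k : L2R) :
    waveEquiv hα hαβ hw k = waveMap α β B k := rfl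

/-- The unitary group `U_B(t) = exp(-2πitP_B)`. -/
def momentumGroup (hα : 1 < α) (hαβ : α < β) (hw : 0 < wParam B) (t : ℝ) :
    L2Omega α β ≃ₗᵢ[ℂ] L2Omega α β :=
  ((waveEquiv hα hαβ hw).symm.trans (translation t)).trans (waveEquiv hα hαβ hw)

lemma momentumGroup_apply (hα : 1 < α) (hαβ : α < β) (hw : 0 < wParam B) (t : ℝ)
    (f : L2Omega α β) : momentumGroup hα hαβ hw t f
      = waveEquiv hα hαβ hw (translation t ((waveEquiv hα hαβ hw).symm f)) := rfl

lemma momentumGroup_add (hα : 1 < α) (hαβ : α < β) (hw : 0 < wParam B) (s t : ℝ)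
    (f : L2Omega α β) : momentumGroup hα hαβ hw (s + t) f
      = momentumGroup hα hαβ hw s (momentumGroup hα hαβ hw t f) := by
  simp [momentumGroup_apply, translation_add]

lemma continuous_momentumGroup (hα : 1 < α) (hαβ : α < β) (hw : 0 < wParam B)
    (f : L2Omega α β) : Continuous fun t => momentumGroup hα hαβ hw t f :=
  (waveEquiv hα hαβ hw).continuous.comp (continuous_translation _)

end Surjective

/-! ### Identification of the generator with P_B. -/

section Generator

open Filter Topology

variable {α β : ℝ} {B : Matrix.unitaryGroup (Fin 2) ℂ}

/-- Bounded operators commuting with translations preserve the domain of d/dx; this passes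
regularity from k to the loop and outgoing waves. -/
lemma hasDerivAt_translation_comp {A : L2R →L[ℂ] L2R}
    (hA : ∀ t k, A (translation t k) = translation t (A k)) {c : ℂ} {k l : L2R}
    (h : HasDerivAt (fun t => translation t k) (c • l) 0) :
    HasDerivAt (fun t => translation t (A k)) (c • A l) 0 := by
  have h1 := (A.restrictScalars ℝ).hasFDerivAt.comp_hasDerivAt 0 h
  rw [← map_smul]
  refine h1.congr_of_eventuallyEq (Eventually.of_forall fun t => (hA t k).symm)

lemma hasDerivAt_translation_of_momentumGroup (hα : 1 < α) (hαβ : α < β) (hw : 0 < wParam B)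
    {c : ℂ} {f g : L2Omega α β}
    (h : HasDerivAt (fun t => momentumGroup hα hαβ hw t f) (c • g) 0) :
    HasDerivAt (fun t => translation t ((waveEquiv hα hαβ hw).symm f))
      (c • (waveEquiv hα hαβ hw).symm g) 0 := by
  have h1 := ((waveEquiv hα hαβ hw).symm.toContinuousLinearEquiv.toContinuousLinearMap.restrictScalars
    ℝ).hasFDerivAt.comp_hasDerivAt 0 h
  rw [← map_smul]
  refine h1.congr_of_eventuallyEq (Eventually.of_forall fun t => ?_)
  exact ((waveEquiv hα hαβ hw).symm_apply_apply _).symm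

lemma closure_omega_subset : closure (Omega α β) ⊆ Iic 0 ∪ Icc 1 α ∪ Ici β := by
  refine closure_minimal ?_ ((isClosed_Iic.union isClosed_Icc).union isClosed_Ici)
  rintro x ((hx | hx) | hx)
  · exact Or.inl (Or.inl (mem_Iic.2 (le_of_lt hx)))
  · exact Or.inl (Or.inr (Ioo_subset_Icc_self hx))
  · exact Or.inr (mem_Ici.2 (le_of_lt hx))

/-- A compact interval in the closure of `Ω` lies in the closure of a component. -/
lemma Icc_subset_closure_omega (hα : 1 < α) (hαβ : α < β) {a b : ℝ} (hab : a ≤ b)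
    (h : Icc a b ⊆ closure (Omega α β)) : b ≤ 0 ∨ (1 ≤ a ∧ b ≤ α) ∨ β ≤ a := by
  have h' : ∀ x, a ≤ x → x ≤ b → x ≤ 0 ∨ (1 ≤ x ∧ x ≤ α) ∨ β ≤ x := fun x h1 h2 => by
    rcases closure_omega_subset (h ⟨h1, h2⟩) with (hx | hx) | hx
    · exact Or.inl hx
    · exact Or.inr (Or.inl hx)
    · exact Or.inr (Or.inr hx)
  have h1 := h' (1 / 2)
  have h2 := h' ((α + β) / 2)
  rcases h' a le_rfl hab with ha | ha | ha
  · left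
    by_contra hb
    push Not at hb
    have hb1 : ¬ 1 / 2 ≤ b := fun hb1 => by
      rcases h1 (by linarith) hb1 with h | h | h <;> linarith
    rcases h' b hab le_rfl with h | h | h <;> linarith
  · right; left
    refine ⟨ha.1, ?_⟩
    by_contra hb
    push Not at hb
    have hb1 : ¬ (α + β) / 2 ≤ b := fun hb1 => by
      rcases h2 (by linarith) hb1 with h | h | h <;> linarith
    rcases h' b hab le_rfl with h | h | h <;> linarith
  · exact Or.inr (Or.inr ha)

lemma momentumGraph_of_hasDerivAt (hα : 1 < α) (hαβ : α < β) (hw : 0 < wParam B)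
    {f g : L2Omega α β}
    (h : HasDerivAt (fun t => momentumGroup hα hαβ hw t f) (-(2 * Real.pi * Complex.I) • g) 0) :
    (f, g) ∈ momentumGraph α β B := by
  have hk := hasDerivAt_translation_of_momentumGroup hα hαβ hw h
  obtain ⟨k, rfl⟩ := (waveEquiv hα hαβ hw).surjective f
  obtain ⟨l, rfl⟩ := (waveEquiv hα hαβ hw).surjective g
  rw [LinearIsometryEquiv.symm_apply_apply, LinearIsometryEquiv.symm_apply_apply] at hk
  have hm := hasDerivAt_translation_comp
    (A := (translation 1).toContinuousLinearEquiv.toContinuousLinearMap ∘L loopWave α B)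
    (fun t k => by
      change translation 1 (loopWave α B (translation t k))
        = translation t (translation 1 (loopWave α B k))
      rw [loopWave_translation hw, translation_comm]) hk
  have ho := hasDerivAt_translation_comp
    (A := (translation β).toContinuousLinearEquiv.toContinuousLinearMap ∘L outWave α B)
    (fun t k => by
      change translation β (outWave α B (translation t k))
        = translation t (translation β (outWave α B k))
      rw [outWave_translation hw, translation_comm]) hk
  obtain ⟨K, hK⟩ := exists_isPrimitiveVersion hk
  obtain ⟨M, hM⟩ := exists_isPrimitiveVersion hm
  obtain ⟨O, hO⟩ := exists_isPrimitiveVersion ho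
  change IsPrimitiveVersion (translation 1 (loopWave α B k)) (translation 1 (loopWave α B l)) M
    at hM
  change IsPrimitiveVersion (translation β (outWave α B k)) (translation β (outWave α B l)) O
    at hO
  have hM' : ∀ᵐ x, loopWave α B k x = M (x + 1) := by
    filter_upwards [ae_comp_add (translation_ae 1 (loopWave α B k)) 1, ae_comp_add hM.ae_eq 1]
      with x h1 h2
    rw [← h2, h1, add_sub_cancel_right]
  have hO' : ∀ᵐ x, outWave α B k x = O (x + β) := by
    filter_upwards [ae_comp_add (translation_ae β (outWave α B k)) β, ae_comp_add hO.ae_eq β]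
      with x h1 h2
    rw [← h2, h1, add_sub_cancel_right]
  have hKc := hK.continuous
  have hMc := hM.continuous
  have hOc := hO.continuous
  -- Continuity upgrades the a.e. wave equations to all points, so they can be evaluated at 0, where
  -- they involve exactly the boundary values.
  have r1 : (fun x => M (x + 1)) = fun x => starRingEnd ℂ (B.1 0 0) * K x
      + starRingEnd ℂ (B.1 1 0) * M (x + (α - 1) + 1) := by
    refine Continuous.ae_eq_iff_eq volume (by fun_prop) (by fun_prop) |>.1 ?_
    filter_upwards [loopWave_ae (α := α) hw k, hM', ae_comp_add hM' (α - 1), hK.ae_eq]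
      with x h1 h2 h3 h4
    rw [← h2, ← h3, ← h4, h1]
  have r2 : (fun x => O (x + β)) = fun x => starRingEnd ℂ (B.1 0 1) * K x
      + starRingEnd ℂ (B.1 1 1) * M (x + (α - 1) + 1) := by
    refine Continuous.ae_eq_iff_eq volume (by fun_prop) (by fun_prop) |>.1 ?_
    filter_upwards [outWave_ae (α := α) (B := B) k, hO', ae_comp_add hM' (α - 1), hK.ae_eq]
      with x h1 h2 h3 h4
    rw [← h2, ← h3, ← h4, h1]
  have b1 := congrFun r1 0
  have b2 := congrFun r2 0
  simp only [zero_add, sub_add_cancel] at b1 b2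
  -- The values on the gaps (0, 1) and (α, β) are immaterial.
  set F : ℝ → ℂ := fun x => if x ≤ 0 then K x else if x ≤ α then M x else O x with hF
  have hF1 : ∀ x, x ≤ 0 → F x = K x := fun x hx => if_pos hx
  have hF2 : ∀ x, 1 ≤ x → x ≤ α → F x = M x := fun x hx hx' => by
    simp only [hF]; rw [if_neg (by linarith), if_pos hx']
  have hF3 : ∀ x, β ≤ x → F x = O x := fun x hx => by
    simp only [hF]; rw [if_neg (by linarith), if_neg (by linarith)]
  refine ⟨F, ⟨?_, ?_, ?_⟩, ?_⟩
  · rw [EventuallyEq, ae_omega_iff]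
    filter_upwards [waveMap_ae (B := B) hα hαβ k, hK.ae_eq, ae_comp_sub hM' 1, ae_comp_sub hO' β]
      with x h1 h2 h3 h4 hx
    rw [waveEquiv_apply]
    rcases hx with (hx | hx) | hx
    · rw [h1.1 hx, h2, hF1 x (le_of_lt hx)]
    · rw [h1.2.1 hx, h3, hF2 x hx.1.le hx.2.le, sub_add_cancel]
    · rw [h1.2.2 hx, h4, hF3 x (le_of_lt hx), sub_add_cancel]
  · intro a b hab hs
    rcases Icc_subset_closure_omega hα hαβ hab hs with h | h | h
    · refine absolutelyContinuousOnInterval_congr (hK.absCont a b) fun x hx => hF1 x ?_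
      rw [uIcc_of_le hab] at hx
      exact hx.2.trans h
    · refine absolutelyContinuousOnInterval_congr (hM.absCont a b) fun x hx => ?_
      rw [uIcc_of_le hab] at hx
      exact hF2 x (h.1.trans hx.1) (hx.2.trans h.2)
    · refine absolutelyContinuousOnInterval_congr (hO.absCont a b) fun x hx => hF3 x ?_
      rw [uIcc_of_le hab] at hx
      exact h.trans hx.1
  · rw [ae_omega_iff]
    filter_upwards [waveMap_ae (B := B) hα hαβ l, hK.hasDerivAt, hM.hasDerivAt, hO.hasDerivAt,
      translation_ae 1 (loopWave α B l), translation_ae β (outWave α B l)]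
      with x h1 h2 h3 h4 h5 h6 hx
    rw [waveEquiv_apply]
    rcases hx with (hx | hx) | hx
    · rw [h1.1 hx]
      exact h2.congr_of_eventuallyEq
        (eventuallyEq_of_mem (Iio_mem_nhds hx) fun y hy => hF1 y (le_of_lt hy))
    · rw [h1.2.1 hx, ← h5]
      exact h3.congr_of_eventuallyEq
        (eventuallyEq_of_mem (Ioo_mem_nhds hx.1 hx.2) fun y hy => hF2 y hy.1.le hy.2.le)
    · rw [h1.2.2 hx, ← h6]
      exact h4.congr_of_eventuallyEq
        (eventuallyEq_of_mem (Ioi_mem_nhds hx) fun y hy => hF3 y (le_of_lt hy))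
  · have e0 := hF1 0 le_rfl
    have e1 := hF2 1 le_rfl hα.le
    have e2 := hF2 α hα.le le_rfl
    have e3 := hF3 β le_rfl
    ext i
    fin_cases i
    · simp only [Matrix.mulVec, dotProduct, Fin.sum_univ_two]
      simp [e0, e1, e3, b1, b2]
      -- The wave equations give the condition in the form with `B*`; `B B* = 1` converts it.
      linear_combination K 0 * unitary_row_zero B + M α * unitary_rows B
    · simp only [Matrix.mulVec, dotProduct, Fin.sum_univ_two]
      simp [e2, e1, e3, b1, b2]
      linear_combination K 0 * unitary_rows' B + M α * unitary_row_one B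

lemma ae_mem_omega_of_mem_closure :
    ∀ᵐ x : ℝ, x ∈ closure (Omega α β) → x ∈ Omega α β := by
  have : ({0, 1, α, β} : Set ℝ)ᶜ ∈ ae (volume : Measure ℝ) :=
    compl_mem_ae_iff.2 ((Set.toFinite _).measure_zero volume)
  filter_upwards [this] with x hx hx'
  simp only [mem_compl_iff, mem_insert_iff, mem_singleton_iff, not_or] at hx
  rcases closure_omega_subset hx' with (h | h) | h
  · exact Or.inl (Or.inl (lt_of_le_of_ne h hx.1))
  · exact Or.inl (Or.inr ⟨lt_of_le_of_ne h.1 (Ne.symm hx.2.1), lt_of_le_of_ne h.2 hx.2.2.1⟩)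
  · exact Or.inr (lt_of_le_of_ne h (Ne.symm hx.2.2.2))

/-- Here f' = -f, so f is a multiple of e^{-x} on each component. Square integrability at -∞ forces
F(0) = 0. Then the boundary condition gives |F(1)| ≤ |F(α)|, against decay on (1, α), so F(α) = 0
and hence F(β) = 0. -/
lemma momentumGraph_deficiency (hα : 1 < α) {f g : L2Omega α β}
    (h : (f, g) ∈ momentumGraph α β B) (hfg : (2 * Real.pi * Complex.I : ℂ) • g = -f) : f = 0 := by
  obtain ⟨F, hF, hb⟩ := h
  have hder : ∀ᵐ x, x ∈ Omega α β → HasDerivAt F (-F x) x := by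
    have e1 : ∀ᵐ x ∂(volume.restrict (Omega α β)), 2 * Real.pi * Complex.I * g x = -f x := by
      filter_upwards [Lp.coeFn_smul (2 * Real.pi * Complex.I : ℂ) g, Lp.coeFn_neg f] with x h1 h2
      rw [hfg, h2] at h1
      exact h1.symm
    filter_upwards [ae_omega_iff.1 e1, ae_omega_iff.1 hF.hasDerivAt, ae_omega_iff.1 hF.ae_eq]
      with x h1 h2 h3 hx
    have := h2 hx
    rwa [show 2 * Real.pi * Complex.I * g x = -F x by rw [← h3 hx]; exact h1 hx] at this
  have hconst : ∀ a b : ℝ, a ≤ b → Icc a b ⊆ closure (Omega α β) →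
      Real.exp a • F a = Real.exp b • F b := by
    intro a b hab hs
    have hexp : AbsolutelyContinuousOnInterval Real.exp a b :=
      Real.contDiff_exp.contDiffOn.absolutelyContinuousOnInterval
    obtain ⟨C, hC⟩ := (hexp.smul (hF.absCont a b hab hs)).const_of_ae_hasDerivAt_zero (by
      filter_upwards [hder, ae_mem_omega_of_mem_closure (α := α) (β := β)] with x h1 h2 hx
      rw [uIcc_of_le hab] at hx
      have := (Real.hasDerivAt_exp x).smul (h1 (h2 (hs hx)))
      simpa using this)
    have ha := hC a left_mem_uIcc
    have hb := hC b right_mem_uIcc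
    simp only [Pi.smul_apply'] at ha hb
    rw [ha, hb]
  have hc1 : Iic (0 : ℝ) ⊆ closure (Omega α β) := by
    rw [← closure_Iio (a := (0 : ℝ))]
    exact closure_mono (subset_union_left.trans subset_union_left)
  have hc2 : Icc 1 α ⊆ closure (Omega α β) := by
    rw [← closure_Ioo hα.ne]
    exact closure_mono (subset_union_right.trans subset_union_left)
  have hc3 : Ici β ⊆ closure (Omega α β) := by
    rw [← closure_Ioi β]
    exact closure_mono subset_union_right
  have h0 : F 0 = 0 := by
    have hint : IntegrableOn (fun x => ‖f x‖ ^ 2) (Iio 0) :=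
      IntegrableOn.mono_set (t := Omega α β) (integrable_norm_sq f)
        (subset_union_left.trans subset_union_left)
    -- For x < 0, |F(x)| = e^{-x} |F(0)| ≥ |F(0)|, and a nonzero constant is not integrable on a
    -- half-line.
    have hci : IntegrableOn (fun _ : ℝ => ‖F 0‖ ^ 2) (Iio (0 : ℝ)) := by
      refine Integrable.mono' hint aestronglyMeasurable_const ?_
      rw [ae_restrict_iff' measurableSet_Iio]
      filter_upwards [ae_omega_iff.1 hF.ae_eq] with x h1 hx
      have hx0 : x < 0 := hx
      have h2 := hconst x 0 hx0.le (Icc_subset_Iic_self.trans hc1)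
      rw [Real.exp_zero, one_smul] at h2
      rw [h1 (Or.inl (Or.inl hx)), ← h2, norm_smul, Real.norm_of_nonneg (by positivity),
        Real.norm_of_nonneg (Real.exp_pos x).le]
      gcongr
      exact mul_le_of_le_one_left (norm_nonneg _) (Real.exp_le_one_iff.2 hx0.le)
    rw [integrableOn_const_iff] at hci
    simpa using hci
  have h1 := hconst 1 α hα.le hc2
  have bd0 := congrFun hb 0
  have bd1 := congrFun hb 1
  simp only [Matrix.mulVec, dotProduct, Fin.sum_univ_two] at bd0 bd1
  simp only [Matrix.cons_val_zero, Matrix.cons_val_one, h0] at bd0 bd1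
  have f1 : F 1 = starRingEnd ℂ (B.1 1 0) * F α := by
    rw [← bd1]
    linear_combination (-F 1) * unitary_col_zero B - F β * unitary_cols B
      + starRingEnd ℂ (B.1 0 0) * bd0
  have f2 : F β = starRingEnd ℂ (B.1 1 1) * F α := by
    rw [← bd1]
    linear_combination (-F 1) * unitary_cols' B - F β * unitary_col_one B
      + starRingEnd ℂ (B.1 0 1) * bd0
  have hnorm := norm_sq_scattering B 0 (F α)
  simp only [mul_zero, zero_add, norm_zero, ← f1, ← f2] at hnorm
  have hα0 : F α = 0 := by
    have h2 : Real.exp 1 * ‖F 1‖ = Real.exp α * ‖F α‖ := by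
      have := congrArg norm h1
      rwa [norm_smul, norm_smul, Real.norm_of_nonneg (Real.exp_pos _).le,
        Real.norm_of_nonneg (Real.exp_pos _).le] at this
    have h3 : ‖F 1‖ ≤ ‖F α‖ := by
      refine (sq_le_sq₀ (norm_nonneg _) (norm_nonneg _)).1 ?_
      nlinarith [sq_nonneg ‖F β‖]
    have h4 : Real.exp 1 < Real.exp α := Real.exp_lt_exp.2 hα
    have h5 := Real.exp_pos 1
    have : ‖F α‖ = 0 := by nlinarith [norm_nonneg (F α)]
    exact norm_eq_zero.1 this
  have hz : ∀ x ∈ Omega α β, F x = 0 := by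
    rintro x ((hx | hx) | hx)
    · have := hconst x 0 (le_of_lt hx) (Icc_subset_Iic_self.trans hc1)
      simpa [h0, (Real.exp_pos x).ne'] using this
    · have := hconst x α hx.2.le ((Icc_subset_Icc_left hx.1.le).trans hc2)
      simpa [hα0, (Real.exp_pos x).ne'] using this
    · have := hconst β x (le_of_lt hx) (Icc_subset_Ici_self.trans hc3)
      simpa [f2, hα0, (Real.exp_pos x).ne', eq_comm] using this
  refine Lp.ext ((hF.ae_eq.trans ?_).trans (Lp.coeFn_zero _ _ _).symm)
  rw [EventuallyEq, ae_omega_iff]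
  exact Eventually.of_forall hz

lemma hasDerivAt_of_momentumGraph (hα : 1 < α) (hαβ : α < β) (hw : 0 < wParam B)
    {f g : L2Omega α β} (h : (f, g) ∈ momentumGraph α β B) :
    HasDerivAt (fun t => momentumGroup hα hαβ hw t f) (-(2 * Real.pi * Complex.I) • g) 0 := by
  set c : ℂ := 2 * Real.pi * Complex.I with hc
  have hc0 : c ≠ 0 := by simp [hc, Real.pi_ne_zero]
  -- The group's generator supplies a solution with the same right-hand side as (f, g); it also lies
  -- in the graph of P_B, so the difference falls under `momentumGraph_deficiency`.
  obtain ⟨f₁, hf₁⟩ := exists_resolvent (momentumGroup_add hα hαβ hw)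
    (continuous_momentumGroup hα hαβ hw) (f + c • g)
  obtain ⟨g₁, hg₁⟩ : ∃ g₁ : L2Omega α β, f₁ - (f + c • g) = -c • g₁ :=
    ⟨(-c)⁻¹ • (f₁ - (f + c • g)), (smul_inv_smul₀ (neg_ne_zero.2 hc0) _).symm⟩
  rw [hg₁] at hf₁
  have h₁ := momentumGraph_of_hasDerivAt hα hαβ hw hf₁
  have hcg : c • g₁ = f + c • g - f₁ := by
    rw [← neg_sub f₁, hg₁, neg_smul, neg_neg]
  have h₂ := (momentumGraph α β B).sub_mem h h₁
  have hf : f - f₁ = 0 := momentumGraph_deficiency hα h₂ (by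
    change c • (g - g₁) = -(f - f₁)
    rw [smul_sub, hcg]; abel)
  have hf' : f = f₁ := sub_eq_zero.1 hf
  have hg : g = g₁ := by
    have : c • g₁ = c • g := by rw [hcg, hf', add_sub_cancel_left]
    exact (smul_right_injective _ hc0 this).symm
  rw [hf', hg]
  exact hf₁

lemma isUnitaryGroupOf_momentumGroup (hα : 1 < α) (hαβ : α < β) (hw : 0 < wParam B) :
    IsUnitaryGroupOf (momentumGroup hα hαβ hw) (momentum α β B) where
  map_add := momentumGroup_add hα hαβ hw
  continuous := continuous_momentumGroup hα hαβ hw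
  generator f g := by
    rw [momentum_graph]
    exact ⟨hasDerivAt_of_momentumGraph hα hαβ hw, momentumGraph_of_hasDerivAt hα hαβ hw⟩

end Generator

/-! ### Multiplication operators between weighted L² spaces. -/

section Multiplication

open Filter Topology ENNReal

variable {X : Type*} [MeasurableSpace X] {μ ν : Measure X} {u : X → ℂ}

lemma eLpNorm_mul_withDensity (hu : Measurable u) (hμ : μ = ν.withDensity fun x => ‖u x‖ₑ ^ 2)
    {g : X → ℂ} (hg : AEStronglyMeasurable g μ) :
    eLpNorm (fun x => u x * g x) 2 ν = eLpNorm g 2 μ := by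
  rw [eLpNorm_eq_lintegral_rpow_enorm_toReal two_ne_zero ofNat_ne_top,
    eLpNorm_eq_lintegral_rpow_enorm_toReal two_ne_zero ofNat_ne_top]
  congr 1
  have hm : AEMeasurable (fun x => ‖g x‖ₑ ^ (2 : ℝ≥0∞).toReal) μ := hg.enorm.pow_const _
  rw [hμ] at hm ⊢
  rw [lintegral_withDensity_eq_lintegral_mul₀' (by fun_prop) hm]
  refine lintegral_congr fun x => ?_
  simp [enorm_mul, mul_pow]

lemma mutual_absolutelyContinuous (hu : Measurable u) (hu0 : ∀ x, u x ≠ 0)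
    (hμ : μ = ν.withDensity fun x => ‖u x‖ₑ ^ 2) : μ ≪ ν ∧ ν ≪ μ := by
  rw [hμ]
  exact ⟨withDensity_absolutelyContinuous _ _, withDensity_absolutelyContinuous' (by fun_prop)
    (Eventually.of_forall fun x => by simp [hu0 x])⟩

lemma memLp_mul_withDensity (hu : Measurable u) (hu0 : ∀ x, u x ≠ 0)
    (hμ : μ = ν.withDensity fun x => ‖u x‖ₑ ^ 2) {g : X → ℂ} (hg : MemLp g 2 μ) :
    MemLp (fun x => u x * g x) 2 ν :=
  ⟨hu.aestronglyMeasurable.mul (hg.1.mono_ac (mutual_absolutelyContinuous hu hu0 hμ).2), by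
    rw [eLpNorm_mul_withDensity hu hμ hg.1]; exact hg.2⟩

/-- Multiplication by a nowhere vanishing function `u` is a unitary map from `L²(|u|² ν)`
to `L²(ν)`. -/
def mulEquiv (hu : Measurable u) (hu0 : ∀ x, u x ≠ 0)
    (hμ : μ = ν.withDensity fun x => ‖u x‖ₑ ^ 2) : Lp ℂ 2 μ ≃ₗᵢ[ℂ] Lp ℂ 2 ν :=
  LinearIsometryEquiv.ofSurjective
    { toFun := fun g => (memLp_mul_withDensity hu hu0 hμ (Lp.memLp g)).toLp _
      map_add' := fun f g => by
        apply Lp.ext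
        filter_upwards [(memLp_mul_withDensity hu hu0 hμ (Lp.memLp (f + g))).coeFn_toLp,
          Lp.coeFn_add ((memLp_mul_withDensity hu hu0 hμ (Lp.memLp f)).toLp _)
            ((memLp_mul_withDensity hu hu0 hμ (Lp.memLp g)).toLp _),
          (memLp_mul_withDensity hu hu0 hμ (Lp.memLp f)).coeFn_toLp,
          (memLp_mul_withDensity hu hu0 hμ (Lp.memLp g)).coeFn_toLp,
          (mutual_absolutelyContinuous hu hu0 hμ).2 (Lp.coeFn_add f g)] with x h1 h2 h3 h4 h5
        rw [h1, h2, Pi.add_apply, h3, h4, h5, Pi.add_apply, mul_add]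
      map_smul' := fun c f => by
        apply Lp.ext
        filter_upwards [(memLp_mul_withDensity hu hu0 hμ (Lp.memLp (c • f))).coeFn_toLp,
          Lp.coeFn_smul c ((memLp_mul_withDensity hu hu0 hμ (Lp.memLp f)).toLp _),
          (memLp_mul_withDensity hu hu0 hμ (Lp.memLp f)).coeFn_toLp,
          (mutual_absolutelyContinuous hu hu0 hμ).2 (Lp.coeFn_smul c f)] with x h1 h2 h3 h5
        rw [h1, RingHom.id_apply, h2, Pi.smul_apply, h3, h5, Pi.smul_apply, smul_eq_mul,
          smul_eq_mul, mul_left_comm]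
      norm_map' := fun f => by
        change ‖(memLp_mul_withDensity hu hu0 hμ (Lp.memLp f)).toLp _‖ = _
        rw [Lp.norm_toLp, eLpNorm_mul_withDensity hu hμ (Lp.aestronglyMeasurable f), Lp.norm_def] }
    (fun G => by
      have hac := mutual_absolutelyContinuous hu hu0 hμ
      have hG : AEStronglyMeasurable (fun x => (u x)⁻¹ * G x) μ :=
        hu.inv.aestronglyMeasurable.mul ((Lp.aestronglyMeasurable G).mono_ac hac.1)
      have hG2 : MemLp (fun x => (u x)⁻¹ * G x) 2 μ := by
        refine ⟨hG, ?_⟩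
        rw [← eLpNorm_mul_withDensity hu hμ hG]
        simp only [mul_inv_cancel_left₀ (hu0 _)]
        exact (Lp.memLp G).2
      refine ⟨hG2.toLp _, Lp.ext ?_⟩
      filter_upwards [(memLp_mul_withDensity hu hu0 hμ (Lp.memLp (hG2.toLp _))).coeFn_toLp,
        hac.2 hG2.coeFn_toLp] with x h1 h2
      refine h1.trans ?_
      rw [h2, mul_inv_cancel_left₀ (hu0 _)])

lemma mulEquiv_ae (hu : Measurable u) (hu0 : ∀ x, u x ≠ 0)
    (hμ : μ = ν.withDensity fun x => ‖u x‖ₑ ^ 2) (g : Lp ℂ 2 μ) :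
    mulEquiv hu hu0 hμ g =ᵐ[ν] fun x => u x * g x :=
  (memLp_mul_withDensity hu hu0 hμ (Lp.memLp g)).coeFn_toLp

end Multiplication

/-! ### The Fourier transform diagonalizes translations. -/

section Fourier

open Filter Topology
open scoped FourierTransform SchwartzMap

lemma e_eq_exp (x : ℝ) : e x = Complex.exp ((2 * Real.pi * x : ℝ) * Complex.I) := by
  rw [e]; congr 1; push_cast; ring

lemma norm_e (x : ℝ) : ‖e x‖ = 1 := by
  rw [e_eq_exp, Complex.norm_exp_ofReal_mul_I]

lemma e_ne_zero (x : ℝ) : e x ≠ 0 := Complex.exp_ne_zero _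

lemma continuous_e : Continuous e := by
  unfold e; fun_prop

lemma fourier_comp_sub (f : ℝ → ℂ) (t l : ℝ) :
    𝓕 (fun x => f (x - t)) l = e (-(t * l)) * 𝓕 f l := by
  rw [Real.fourier_real_eq_integral_exp_smul, Real.fourier_real_eq_integral_exp_smul,
    ← integral_sub_right_eq_self
      (fun v : ℝ => Complex.exp (↑(-2 * Real.pi * v * l) * Complex.I) • f v) t,
    ← integral_const_mul]
  refine integral_congr_ae (Eventually.of_forall fun v => ?_)
  simp only [smul_eq_mul]
  rw [← mul_assoc, e_eq_exp, ← Complex.exp_add]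
  congr 2
  push_cast
  ring

/-- Multiplication by `e(-tλ)` on `L²(ℝ)`. -/
def modulation (t : ℝ) : L2R ≃ₗᵢ[ℂ] L2R :=
  mulEquiv (u := fun l => e (-(t * l))) (continuous_e.comp (by fun_prop)).measurable
    (fun _ => e_ne_zero _) (by
      have : ∀ x : ℝ, ‖e (-(t * x))‖ₑ ^ 2 = 1 := fun x => by
        rw [← ofReal_norm, norm_e]; simp
      simp only [this]
      exact withDensity_one.symm)

lemma modulation_ae (t : ℝ) (g : L2R) : modulation t g =ᵐ[volume] fun l => e (-(t * l)) * g l :=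
  mulEquiv_ae _ _ _ g

lemma translation_toLp (t : ℝ) (f : 𝓢(ℝ, ℂ)) :
    translation t (f.toLp 2) = (SchwartzMap.compSubConstCLM ℂ t f).toLp 2 := by
  apply Lp.ext
  filter_upwards [translation_ae t (f.toLp 2), ae_comp_sub (f.coeFn_toLp 2 volume) t,
    (SchwartzMap.compSubConstCLM ℂ t f).coeFn_toLp 2] with x h1 h2 h3
  rw [h1, h2, h3, SchwartzMap.compSubConstCLM_apply]

/-- The Fourier transform intertwines translations and modulations. -/
lemma fourier_translation (t : ℝ) (f : L2R) :
    Lp.fourierTransformₗᵢ ℝ ℂ (translation t f) = modulation t (Lp.fourierTransformₗᵢ ℝ ℂ f) := by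
  -- Both sides are continuous in f, so Schwartz functions suffice; there the Fourier integral and a
  -- substitution produce the phase.
  refine DenseRange.induction_on (SchwartzMap.denseRange_toLpCLM (F := ℂ) (E := ℝ)
    (p := 2) (μ := volume) ENNReal.ofNat_ne_top) f ?_ fun f => ?_
  · exact isClosed_eq ((LinearIsometryEquiv.continuous _).comp (LinearIsometryEquiv.continuous _))
      ((LinearIsometryEquiv.continuous _).comp (LinearIsometryEquiv.continuous _))
  · rw [SchwartzMap.toLpCLM_apply, translation_toLp]
    have h1 : ∀ g : 𝓢(ℝ, ℂ), Lp.fourierTransformₗᵢ ℝ ℂ (g.toLp 2) = (𝓕 g).toLp 2 :=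
      fun g => g.toLp_fourier_eq
    rw [h1, h1]
    apply Lp.ext
    filter_upwards [(𝓕 (SchwartzMap.compSubConstCLM ℂ t f)).coeFn_toLp 2,
      modulation_ae t ((𝓕 f).toLp 2), (𝓕 f).coeFn_toLp 2] with l h2 h3 h4
    rw [h2, h3, h4, SchwartzMap.fourier_coe, SchwartzMap.fourier_coe, ← fourier_comp_sub]
    rfl

end Fourier

/-! ### The spectral measure σ_B. -/

section SpectralMeasure

open Filter Topology

variable {α : ℝ} {B : Matrix.unitaryGroup (Fin 2) ℂ}

lemma aCoeff_ne_zero (hw : 0 < wParam B) (l : ℝ) : aCoeff α B l ≠ 0 := by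
  have h0 : B.1 0 0 ≠ 0 := norm_pos_iff.1 hw
  refine mul_ne_zero (mul_ne_zero (inv_ne_zero ((map_ne_zero _).2 h0)) (e_ne_zero l)) ?_
  intro h
  have h1 := congrArg norm (sub_eq_zero.1 h)
  rw [norm_one, norm_mul, norm_e, mul_one] at h1
  exact (norm_conj_entry_lt_one hw).ne h1.symm

lemma continuous_aCoeff : Continuous (aCoeff α B) := by
  have := continuous_e
  unfold aCoeff
  fun_prop

/-- Written in this direction so that `mulEquiv` with u = a_B goes from L²(dλ) to L²(σ_B). -/
lemma volume_eq_sigma_withDensity (hw : 0 < wParam B) :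
    volume = (sigma α B).withDensity fun l => ‖aCoeff α B l‖ₑ ^ 2 := by
  have hm : Measurable fun l => ENNReal.ofReal ((‖aCoeff α B l‖ ^ 2)⁻¹) := by
    have := (continuous_aCoeff (α := α) (B := B)).measurable
    fun_prop
  have hpos : ∀ l, 0 < (‖aCoeff α B l‖ ^ 2)⁻¹ := fun l => by
    have := norm_pos_iff.2 (aCoeff_ne_zero (α := α) hw l)
    positivity
  have h := withDensity_inv_same (μ := volume) hm
    (Eventually.of_forall fun l => (ENNReal.ofReal_pos.2 (hpos l)).ne') (Eventually.of_forall fun l => by simp)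
  rw [sigma]
  conv_lhs => rw [← h]
  congr 1
  funext l
  rw [← ENNReal.ofReal_inv_of_pos (hpos l), inv_inv, ENNReal.ofReal_pow (norm_nonneg _),
    ofReal_norm]

end SpectralMeasure

/-! ### Unitary equivalence and the spectral representation. -/

section Equivalence

variable {α β : ℝ} {B B' : Matrix.unitaryGroup (Fin 2) ℂ}

/-- Both groups are conjugate to translation on L²(ℝ), which does not depend on B. -/
lemma unitarilyEquivalent_momentumGroup (hα : 1 < α) (hαβ : α < β) (hw : 0 < wParam B)
    (hw' : 0 < wParam B') :
    UnitarilyEquivalent (momentumGroup hα hαβ hw) (momentumGroup hα hαβ hw') :=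
  ⟨(waveEquiv hα hαβ hw).symm.trans (waveEquiv hα hαβ hw'), fun t f => by
    simp [momentumGroup_apply]⟩

lemma exists_spectral_representation (hα : 1 < α) (hαβ : α < β) (hw : 0 < wParam B) :
    ∃ W : L2Omega α β ≃ₗᵢ[ℂ] Lp ℂ 2 (sigma α B), ∀ (t : ℝ) (f : L2Omega α β),
      W (momentumGroup hα hαβ hw t f) =ᵐ[sigma α B] fun l => e (-(t * l)) * W f l := by
  have hu := (continuous_aCoeff (α := α) (B := B)).measurable
  have hu0 := aCoeff_ne_zero (α := α) hw
  have hσ := volume_eq_sigma_withDensity (α := α) hw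
  have hac := (mutual_absolutelyContinuous hu hu0 hσ).2
  -- Multiplication by a_B commutes with e(-tλ) and only changes the measure.
  refine ⟨((waveEquiv hα hαβ hw).symm.trans (Lp.fourierTransformₗᵢ ℝ ℂ)).trans
    (mulEquiv hu hu0 hσ), fun t f => ?_⟩
  set g : L2R := Lp.fourierTransformₗᵢ ℝ ℂ ((waveEquiv hα hαβ hw).symm f)
  have h1 : Lp.fourierTransformₗᵢ ℝ ℂ ((waveEquiv hα hαβ hw).symm (momentumGroup hα hαβ hw t f))
      = modulation t g := by
    rw [momentumGroup_apply, LinearIsometryEquiv.symm_apply_apply, fourier_translation]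
  simp only [LinearIsometryEquiv.trans_apply, h1]
  filter_upwards [mulEquiv_ae hu hu0 hσ (modulation t g), mulEquiv_ae hu hu0 hσ g,
    hac (modulation_ae t g)] with l h2 h3 h4
  rw [h2, h4]
  refine (mul_left_comm _ _ _).trans ?_
  rw [← h3]

end Equivalence

end ExteriorMomentum

end

theorem corollary3p31 (α β : ℝ) (hα : 1 < α) (hαβ : α < β) :
    -- the unitary groups `U_B(t)`, with `0 < w(B) < 1`, exist and are determined by `P_B`;
    -- they are pairwise unitarily equivalent
    (∀ B : Matrix.unitaryGroup (Fin 2) ℂ,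
      0 < ExteriorMomentum.wParam B → ExteriorMomentum.wParam B < 1 →
      ∃! U : ℝ → ExteriorMomentum.L2Omega α β ≃ₗᵢ[ℂ] ExteriorMomentum.L2Omega α β,
        ExteriorMomentum.IsUnitaryGroupOf U (ExteriorMomentum.momentum α β B)) ∧
    (∀ B B' : Matrix.unitaryGroup (Fin 2) ℂ,
      0 < ExteriorMomentum.wParam B → ExteriorMomentum.wParam B < 1 →
      0 < ExteriorMomentum.wParam B' → ExteriorMomentum.wParam B' < 1 →
      ∀ U U' : ℝ → ExteriorMomentum.L2Omega α β ≃ₗᵢ[ℂ] ExteriorMomentum.L2Omega α β,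
        ExteriorMomentum.IsUnitaryGroupOf U (ExteriorMomentum.momentum α β B) →
        ExteriorMomentum.IsUnitaryGroupOf U' (ExteriorMomentum.momentum α β B') →
        ExteriorMomentum.UnitarilyEquivalent U U') ∧
    -- each is unitarily equivalent to multiplication by `e(-tλ)` on `L²(σ_B)`, and `σ_B` and
    -- Lebesgue measure are mutually absolutely continuous
    (∀ B : Matrix.unitaryGroup (Fin 2) ℂ,
      0 < ExteriorMomentum.wParam B → ExteriorMomentum.wParam B < 1 →
      (∀ U : ℝ → ExteriorMomentum.L2Omega α β ≃ₗᵢ[ℂ] ExteriorMomentum.L2Omega α β,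
        ExteriorMomentum.IsUnitaryGroupOf U (ExteriorMomentum.momentum α β B) →
        ∃ W : ExteriorMomentum.L2Omega α β ≃ₗᵢ[ℂ]
            MeasureTheory.Lp ℂ 2 (ExteriorMomentum.sigma α B),
          ∀ (t : ℝ) (f : ExteriorMomentum.L2Omega α β),
            W (U t f) =ᵐ[ExteriorMomentum.sigma α B]
              fun l => ExteriorMomentum.e (-(t * l)) * W f l) ∧
      MeasureTheory.Measure.AbsolutelyContinuous
        (ExteriorMomentum.sigma α B) MeasureTheory.volume ∧
      MeasureTheory.Measure.AbsolutelyContinuous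
        MeasureTheory.volume (ExteriorMomentum.sigma α B)) := by
  -- Uniqueness reduces claims about an arbitrary group generated by -2πiP_B to the explicit one.
  have uniq : ∀ (B : Matrix.unitaryGroup (Fin 2) ℂ) (hw : 0 < ExteriorMomentum.wParam B)
      (U : ℝ → ExteriorMomentum.L2Omega α β ≃ₗᵢ[ℂ] ExteriorMomentum.L2Omega α β),
      ExteriorMomentum.IsUnitaryGroupOf U (ExteriorMomentum.momentum α β B) →
      U = ExteriorMomentum.momentumGroup hα hαβ hw := fun B hw U hU =>
    hU.unique (ExteriorMomentum.isUnitaryGroupOf_momentumGroup hα hαβ hw)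
  refine ⟨fun B hw _ => ⟨ExteriorMomentum.momentumGroup hα hαβ hw,
    ExteriorMomentum.isUnitaryGroupOf_momentumGroup hα hαβ hw, uniq B hw⟩, ?_, ?_⟩
  · intro B B' hw _ hw' _ U U' hU hU'
    rw [uniq B hw U hU, uniq B' hw' U' hU']
    exact ExteriorMomentum.unitarilyEquivalent_momentumGroup hα hαβ hw hw'
  · intro B hw _
    refine ⟨fun U hU => ?_, ?_⟩
    · rw [uniq B hw U hU]
      exact ExteriorMomentum.exists_spectral_representation hα hαβ hw
    · have h := ExteriorMomentum.mutual_absolutelyContinuous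
        (ExteriorMomentum.continuous_aCoeff (α := α) (B := B)).measurable
        (ExteriorMomentum.aCoeff_ne_zero (α := α) hw)
        (ExteriorMomentum.volume_eq_sigma_withDensity (α := α) hw)
      exact ⟨h.2, h.1⟩
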